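/- Let $\mathfrak g$ be a (finite-dimensional) complex simple Lie algebra with a Cartan subalgebra $\mathfrak t$, root system $\Delta$, simple roots $\Pi$, highest root $\theta$, and Borel subalgebra $\mathfrak b=\mathfrak t\oplus\bigoplus_{\gamma\in\Delta^+}\mathfrak g_\gamma$. Let $\mathfrak{Par}(\mathfrak g)$ be the set of standard parabolic subalgebras (the subalgebras of $\mathfrak g$ containing $\mathfrak b$), and $\mathfrak{Ab}(\mathfrak g)$ the set of abelian ideals of $\mathfrak b$ (the subspaces $\mathfrak a\subset\mathfrak b$ with $[\mathfrak b,\mathfrak a]\subset\mathfrak a$ and $[\mathfrak a,\mathfrak a]=0$). Let $f_1:\mathfrak{Ab}(\mathfrak g)\to\mathfrak{Par}(\mathfrak g)$ send $\mathfrak a$ to its normaliser in $\mathfrak g$. For $S\subset\Pi$, let $\deg$ be the additive function on $\Delta$ with $\deg(\alpha)=1$ for $\alpha\in S$ and $\deg(\alpha)=0$ for $\alpha\in\Pi\setminus S$. This gives the grading $\mathfrak g=\bigoplus_{i\in\mathbb Z}\mathfrak g(i;S)$ with $\mathfrak t\subset\mathfrak g(0;S)$ and $\mathfrak g_\gamma\subset\mathfrak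 g(\deg\gamma;S)$. Put $\mathfrak g(\ge j;S)=\bigoplus_{i\ge j}\mathfrak g(i;S)$ and $\mathfrak p(S)=\mathfrak g(\ge 0;S)\in\mathfrak{Par}(\mathfrak g)$. For $\mathfrak p\in\mathfrak{Par}(\mathfrak g)$, let $S(\mathfrak p)\subset\Pi$ be the set of simple roots that are not roots of the Levi subalgebra of $\mathfrak p$ containing $\mathfrak t$, let $\mathrm{ht}(\mathfrak p)$ be the largest $i$ with $\mathfrak g(i;S(\mathfrak p))\ne 0$, and put $$f_2(\mathfrak p)=\mathfrak g\bigl(\ge[\mathrm{ht}(\mathfrak p)/2]+1;\,S(\mathfrak p)\bigr),$$ where $[x]$ is the integer part of $x$. This is an abelian ideal of $\mathfrak b$, so that $f_2:\mathfrak{Par}(\mathfrak g)\to\mathfrak{Ab}(\mathfrak g)$. (i) If $\Delta$ is of type $A_n$ or $C_n$, then $f_2$ is a bijection, and $f_2=f_1^{-1}$. (ii) If $\theta$ is a fundamental weight, then $f_2$ is not injective, and in particular not a bijection. Explicitly, exactly one simple root $\alpha_\theta$ is not orthogonal to $\theta$; if $S_1$ is the set of simple roots adjacent to $\alpha_\theta$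 in the Dynkin diagram and $S_2=S_1\cup\{\alpha_\theta\}$, then $\mathfrak p(S_1)\ne\mathfrak p(S_2)$ and $f_2(\mathfrak p(S_1))=f_2(\mathfrak p(S_2))$. -/

import Mathlib

noncomputable section

namespace AbelianIdeals

open LieAlgebra LieAlgebra.IsKilling LieModule Module

section

variable {K L : Type*} [Field K] [CharZero K] [LieRing L] [LieAlgebra K L]
  [FiniteDimensional K L] [IsKilling K L]
  {H : LieSubalgebra K L} [H.IsCartanSubalgebra] [IsTriangularizable K H L]

set_option linter.unusedSectionVars false in
lemma lie_mem_of_weights {χ ψ : Weight K H L} {x y : L} {T : Submodule K L}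
    (hx : x ∈ rootSpace H χ) (hy : y ∈ rootSpace H ψ)
    (h : ∀ φ : Weight K H L, (φ.toLinear : Dual K H) = χ.toLinear + ψ.toLinear →
      (rootSpace H φ).toSubmodule ≤ T) : ⁅x, y⁆ ∈ T := by
  have h1 := lie_mem_genWeightSpace_of_mem_genWeightSpace hx hy
  by_cases h0 : genWeightSpace L ((χ : H → K) + (ψ : H → K)) = ⊥
  · rw [h0] at h1
    have : ⁅x, y⁆ = 0 := by simpa using h1
    rw [this]; exact T.zero_mem
  · exact h ⟨_, h0⟩ (by ext z; simp) h1

/-- The Borel subalgebra `𝔟` attached to the Cartan subalgebra `H` and to the base `b` of the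
root system: the sum of `H` and of the root spaces of the positive roots. -/
def borel (b : (rootSystem H).Base) : LieSubalgebra K L where
  toSubmodule := H.toSubmodule ⊔
    ⨆ (γ : H.root) (_ : b.IsPos γ), (rootSpace H (γ : Weight K H L)).toSubmodule
  lie_mem' := by
    set U : Submodule K L :=
      ⨆ (γ : H.root) (_ : b.IsPos γ), (rootSpace H (γ : Weight K H L)).toSubmodule with hU
    have hle : ∀ γ : H.root, b.IsPos γ → (rootSpace H (γ : Weight K H L)).toSubmodule ≤ U :=
      fun γ hγ ↦ le_iSup₂_of_le γ hγ le_rfl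
    have hHU : ∀ x ∈ H, ∀ y ∈ U, ⁅x, y⁆ ∈ U := by
      intro x hx y hy
      refine Submodule.iSup_induction _ (motive := fun y ↦ ⁅x, y⁆ ∈ U) hy ?_ (by simp)
        (fun u v hu hv ↦ by rw [lie_add]; exact U.add_mem hu hv)
      intro γ y hy
      by_cases hγ : b.IsPos γ
      · rw [iSup_pos hγ] at hy
        exact hle γ hγ ((rootSpace H (γ : Weight K H L)).lie_mem (x := (⟨x, hx⟩ : H)) hy)
      · rw [iSup_neg hγ] at hy
        rw [(Submodule.mem_bot K).1 hy]; simp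
    have hUU : ∀ x ∈ U, ∀ y ∈ U, ⁅x, y⁆ ∈ U := by
      intro x hx y hy
      refine Submodule.iSup_induction _ (motive := fun x ↦ ⁅x, y⁆ ∈ U) hx ?_ (by simp)
        (fun u v hu hv ↦ by rw [add_lie]; exact U.add_mem hu hv)
      intro γ x hx
      by_cases hγ : b.IsPos γ
      swap
      · rw [iSup_neg hγ] at hx
        rw [(Submodule.mem_bot K).1 hx]; simp
      rw [iSup_pos hγ] at hx
      refine Submodule.iSup_induction _ (motive := fun y ↦ ⁅x, y⁆ ∈ U) hy ?_ (by simp)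
        (fun u v hu hv ↦ by rw [lie_add]; exact U.add_mem hu hv)
      intro γ' y hy
      by_cases hγ' : b.IsPos γ'
      swap
      · rw [iSup_neg hγ'] at hy
        rw [(Submodule.mem_bot K).1 hy]; simp
      rw [iSup_pos hγ'] at hy
      refine lie_mem_of_weights hx hy fun φ hφ ↦ ?_
      by_cases h0 : φ.IsZero
      · exfalso
        let _ := (rootSystem H).indexNeg
        have e : (rootSystem H).root γ' = (rootSystem H).root (-γ) := by
          have : (φ.toLinear : Dual K H) = 0 := by ext z; simp [h0.eq]
          rw [this] at hφ
          have h2 : (rootSystem H).root (-γ) = - (rootSystem H).root γ :=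
            ((rootSystem H).root_reflectionPerm γ γ).trans ((rootSystem H).reflection_apply_self γ)
          rw [h2]
          exact eq_neg_of_add_eq_zero_right hφ.symm
        have e' : γ' = -γ := (rootSystem H).root.injective e
        have h3 := b.height_reflectionPerm_self γ
        rw [← e'] at h3
        rw [RootPairing.Base.isPos_iff] at hγ hγ'
        omega
      · have hm : φ ∈ H.root := by simpa using h0
        exact hle ⟨φ, hm⟩ (RootPairing.Base.IsPos.add hγ hγ' (by simpa using hφ))
    intro x y hx hy
    obtain ⟨h, hh, u, hu, rfl⟩ := Submodule.mem_sup.1 hx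
    obtain ⟨h', hh', u', hu', rfl⟩ := Submodule.mem_sup.1 hy
    rw [add_lie, lie_add, lie_add, add_assoc]
    refine Submodule.mem_sup.2 ⟨_, H.lie_mem hh hh', _, ?_, rfl⟩
    refine U.add_mem (hHU _ hh _ hu') (U.add_mem ?_ (hUU _ hu _ hu'))
    rw [← lie_skew]
    exact U.neg_mem (hHU _ hh' _ hu)

/-- The standard parabolic subalgebras: the subalgebras of `L` containing `𝔟`. -/
abbrev Par (b : (rootSystem H).Base) : Type _ := {p : LieSubalgebra K L // borel b ≤ p}

/-- `𝔞` is an abelian ideal of `𝔟`: a subspace of `𝔟` with `[𝔟, 𝔞] ⊆ 𝔞` and `[𝔞, 𝔞] = 0`. -/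
structure IsAbelianIdeal (b : (rootSystem H).Base) (a : Submodule K L) : Prop where
  le_borel : a ≤ (borel b).toSubmodule
  lie_mem : ∀ x ∈ borel b, ∀ y ∈ a, ⁅x, y⁆ ∈ a
  lie_eq_zero : ∀ x ∈ a, ∀ y ∈ a, ⁅x, y⁆ = 0

/-- The set of abelian ideals of `𝔟`. -/
abbrev Ab (b : (rootSystem H).Base) : Type _ := {a : Submodule K L // IsAbelianIdeal b a}

/-- An abelian ideal of `𝔟`, as a Lie subalgebra of `L`. -/
def Ab.toLieSubalgebra {b : (rootSystem H).Base} (a : Ab b) : LieSubalgebra K L where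
  toSubmodule := a.1
  lie_mem' := fun {x y} hx hy ↦ by
    rw [a.2.lie_eq_zero x hx y hy]; exact a.1.zero_mem

/-- The map `f₁` sends an abelian ideal to its normaliser in `L`. -/
def f₁ (b : (rootSystem H).Base) (a : Ab b) : Par b :=
  ⟨a.toLieSubalgebra.normalizer, fun x hx ↦
    (LieSubalgebra.mem_normalizer_iff _ x).2 fun y hy ↦ a.2.lie_mem x hx y hy⟩

open Classical in
/-- The degree attached to a set `S` of simple roots: the linear function which is `1` on the
simple roots in `S` and `0` on the other simple roots. It takes integer values on roots. -/
def deg (b : (rootSystem H).Base) (S : Set b.support) : Dual K H →ₗ[K] K :=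
  b.toWeightBasis.constr K fun i ↦ if i ∈ S then 1 else 0

/-- The component `𝔤(i; S)` of the grading attached to `S`. The weights are the roots and `0`; the
weight `0` has degree `0` and its weight space is `H`. -/
def gr (b : (rootSystem H).Base) (S : Set b.support) (i : ℤ) : Submodule K L :=
  ⨆ (χ : Weight K H L) (_ : deg b S χ.toLinear = (i : K)), (rootSpace H χ).toSubmodule

/-- `𝔤(≥ j; S)`, the sum of the `𝔤(i; S)` with `i ≥ j`. -/
def grGE (b : (rootSystem H).Base) (S : Set b.support) (j : ℤ) : Submodule K L :=
  ⨆ (i : ℤ) (_ : j ≤ i), gr b S i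

/-- The height of the grading attached to `S`: the largest `i` with `𝔤(i; S) ≠ 0`. -/
def ht (b : (rootSystem H).Base) (S : Set b.support) : ℤ :=
  sSup {i : ℤ | gr b S i ≠ ⊥}

lemma rootSpace_le_gr (b : (rootSystem H).Base) (S : Set b.support) (χ : Weight K H L) {i : ℤ}
    (h : deg b S χ.toLinear = (i : K)) : (rootSpace H χ).toSubmodule ≤ gr b S i :=
  le_iSup₂_of_le χ h le_rfl

lemma gr_le_grGE (b : (rootSystem H).Base) (S : Set b.support) {i j : ℤ} (h : j ≤ i) :
    gr b S i ≤ grGE b S j :=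
  le_iSup₂_of_le i h le_rfl

lemma lie_mem_gr (b : (rootSystem H).Base) (S : Set b.support) {i j : ℤ} {x y : L}
    (hx : x ∈ gr b S i) (hy : y ∈ gr b S j) : ⁅x, y⁆ ∈ gr b S (i + j) := by
  refine Submodule.iSup_induction _ (motive := fun x ↦ ⁅x, y⁆ ∈ gr b S (i + j)) hx ?_ (by simp)
    (fun u v hu hv ↦ by rw [add_lie]; exact Submodule.add_mem _ hu hv)
  intro χ x hx
  by_cases hχ : deg b S χ.toLinear = (i : K)
  swap
  · rw [iSup_neg hχ] at hx
    rw [(Submodule.mem_bot K).1 hx]; simp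
  rw [iSup_pos hχ] at hx
  refine Submodule.iSup_induction _ (motive := fun y ↦ ⁅x, y⁆ ∈ gr b S (i + j)) hy ?_ (by simp)
    (fun u v hu hv ↦ by rw [lie_add]; exact Submodule.add_mem _ hu hv)
  intro ψ y hy
  by_cases hψ : deg b S ψ.toLinear = (j : K)
  swap
  · rw [iSup_neg hψ] at hy
    rw [(Submodule.mem_bot K).1 hy]; simp
  rw [iSup_pos hψ] at hy
  refine lie_mem_of_weights hx hy fun φ hφ ↦ rootSpace_le_gr b S φ ?_
  rw [hφ, map_add, hχ, hψ]; push_cast; rfl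

lemma grGE_induction (b : (rootSystem H).Base) (S : Set b.support) {j : ℤ} {T : Submodule K L}
    {x y : L} (hx : x ∈ grGE b S j) (h : ∀ i, j ≤ i → ∀ x ∈ gr b S i, ⁅x, y⁆ ∈ T) :
    ⁅x, y⁆ ∈ T := by
  refine Submodule.iSup_induction _ (motive := fun x ↦ ⁅x, y⁆ ∈ T) hx ?_ (by simp)
    (fun u v hu hv ↦ by rw [add_lie]; exact Submodule.add_mem _ hu hv)
  intro i x hx
  by_cases hi : j ≤ i
  · rw [iSup_pos hi] at hx
    exact h i hi x hx
  · rw [iSup_neg hi] at hx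
    rw [(Submodule.mem_bot K).1 hx]; simp

lemma lie_mem_of_grGE (b : (rootSystem H).Base) (S : Set b.support) {j k : ℤ}
    {T : Submodule K L} {x y : L} (hx : x ∈ grGE b S j) (hy : y ∈ grGE b S k)
    (h : ∀ i, j + k ≤ i → gr b S i ≤ T) : ⁅x, y⁆ ∈ T := by
  refine grGE_induction b S hx fun i hi x hx ↦ ?_
  rw [← lie_skew]
  refine T.neg_mem (grGE_induction b S hy fun i' hi' y hy ↦ ?_)
  rw [← lie_skew]
  exact T.neg_mem (h (i + i') (by omega) (lie_mem_gr b S hx hy))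

lemma deg_root_of_mem (b : (rootSystem H).Base) (S : Set b.support) {v : Dual K H}
    (hv : v ∈ AddSubmonoid.closure ((rootSystem H).root '' b.support)) :
    ∃ n : ℕ, deg b S v = n := by
  classical
  induction hv using AddSubmonoid.closure_induction with
  | mem v hv =>
    obtain ⟨i, hi, rfl⟩ := hv
    have : (rootSystem H).root i = b.toWeightBasis ⟨i, hi⟩ := by simp
    rw [this, deg, Basis.constr_basis]
    split_ifs
    · exact ⟨1, by simp⟩
    · exact ⟨0, by simp⟩
  | zero => exact ⟨0, by simp⟩
  | add v w _ _ hv hw =>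
    obtain ⟨m, hm⟩ := hv
    obtain ⟨n, hn⟩ := hw
    exact ⟨m + n, by simp [hm, hn]⟩

lemma root_mem_closure_of_isPos (b : (rootSystem H).Base) {γ : H.root} (hγ : b.IsPos γ) :
    (rootSystem H).root γ ∈ AddSubmonoid.closure ((rootSystem H).root '' b.support) := by
  refine RootPairing.Base.IsPos.induction_on_add hγ
    (p := fun γ ↦ (rootSystem H).root γ ∈
      AddSubmonoid.closure ((rootSystem H).root '' b.support))
    (fun i hi ↦ AddSubmonoid.subset_closure ⟨i, hi, rfl⟩) fun i j k hk ih hj ↦ ?_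
  rw [hk]
  exact AddSubmonoid.add_mem _ ih (AddSubmonoid.subset_closure ⟨j, hj, rfl⟩)

lemma cartan_le_gr_zero (b : (rootSystem H).Base) (S : Set b.support) :
    H.toSubmodule ≤ gr b S 0 := by
  intro x hx
  have hx' : x ∈ rootSpace H (0 : H → K) := by
    rw [rootSpace_zero_eq]; exact hx
  by_cases h0 : genWeightSpace L (0 : H → K) = ⊥
  · have hx'' : x ∈ genWeightSpace L (0 : H → K) := hx'
    erw [h0] at hx''
    have : x = 0 := by simpa using hx''
    rw [this]; exact Submodule.zero_mem _
  · refine rootSpace_le_gr b S ⟨0, h0⟩ ?_ hx'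
    have : (Weight.toLinear K H L ⟨0, h0⟩ : Dual K H) = 0 := by ext z; simp
    rw [this]; simp

lemma borel_le_grGE (b : (rootSystem H).Base) (S : Set b.support) :
    (borel b).toSubmodule ≤ grGE b S 0 := by
  refine sup_le ((cartan_le_gr_zero b S).trans (gr_le_grGE b S le_rfl)) (iSup₂_le fun γ hγ ↦ ?_)
  obtain ⟨n, hn⟩ := deg_root_of_mem b S (root_mem_closure_of_isPos b hγ)
  exact (rootSpace_le_gr b S γ (i := n) (by simpa using hn)).trans
    (gr_le_grGE b S (by positivity))

lemma grGE_le_borel (b : (rootSystem H).Base) (S : Set b.support) {j : ℤ} (hj : 1 ≤ j) :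
    grGE b S j ≤ (borel b).toSubmodule := by
  refine iSup₂_le fun i hi ↦ iSup₂_le fun χ hχ ↦ ?_
  have h0 : ¬ χ.IsZero := by
    intro h0
    have : (χ.toLinear : Dual K H) = 0 := by ext z; simp [h0.eq]
    rw [this, map_zero] at hχ
    have : i = 0 := by exact_mod_cast hχ.symm
    omega
  have hm : χ ∈ H.root := by simpa using h0
  refine le_trans ?_ (le_sup_right : _ ≤ (borel b).toSubmodule)
  refine le_iSup₂_of_le (⟨χ, hm⟩ : H.root) ?_ le_rfl
  let _ := (rootSystem H).indexNeg
  by_contra hneg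
  rw [← RootPairing.Base.IsPos.neg_iff_not] at hneg
  obtain ⟨n, hn⟩ := deg_root_of_mem b S (root_mem_closure_of_isPos b hneg)
  have h2 : (rootSystem H).root (-(⟨χ, hm⟩ : H.root)) = - χ.toLinear :=
    ((rootSystem H).root_reflectionPerm _ _).trans
      ((rootSystem H).reflection_apply_self ⟨χ, hm⟩)
  rw [h2, map_neg, hχ] at hn
  have : -i = (n : ℤ) := by exact_mod_cast hn
  omega

lemma bddAbove_gr (b : (rootSystem H).Base) (S : Set b.support) :
    BddAbove {i : ℤ | gr b S i ≠ ⊥} := by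
  refine Set.Finite.bddAbove ?_
  have hfin : (Set.range fun χ : Weight K H L ↦ deg b S χ.toLinear).Finite := Set.finite_range _
  refine (hfin.preimage (f := fun i : ℤ ↦ (i : K)) Int.cast_injective.injOn).subset fun i hi ↦ ?_
  by_contra hc
  refine hi ?_
  simp only [gr, iSup_eq_bot]
  intro χ hχ
  exact absurd ⟨χ, hχ⟩ hc

lemma gr_eq_bot_of_ht_lt (b : (rootSystem H).Base) (S : Set b.support) {i : ℤ}
    (hi : ht b S < i) : gr b S i = ⊥ := by
  by_contra h
  exact absurd (le_csSup (bddAbove_gr b S) h) (not_le.2 hi)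

/-- The standard parabolic subalgebra `𝔭(S) = 𝔤(≥ 0; S)`. -/
def parOf (b : (rootSystem H).Base) (S : Set b.support) : Par b :=
  ⟨{ toSubmodule := grGE b S 0
     lie_mem' := fun {_ _} hx hy ↦
      lie_mem_of_grGE b S hx hy fun _ hi ↦ gr_le_grGE b S (by omega) },
    fun _ hx ↦ borel_le_grGE b S hx⟩

/-- The roots of the standard Levi subalgebra of `𝔭` (the one containing `H`): the roots `γ` such
that the root spaces of both `γ` and `-γ` lie in `𝔭`. -/
def leviRoots {b : (rootSystem H).Base} (p : Par b) : Set H.root :=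
  {γ | (rootSpace H (γ : Weight K H L)).toSubmodule ≤ p.1.toSubmodule ∧
    (rootSpace H (-(γ : Weight K H L))).toSubmodule ≤ p.1.toSubmodule}

/-- `S(𝔭)`: the simple roots that are not roots of the standard Levi subalgebra of `𝔭`. -/
def simpleSet {b : (rootSystem H).Base} (p : Par b) : Set b.support :=
  {i | (i : H.root) ∉ leviRoots p}

lemma zero_le_ht (b : (rootSystem H).Base) (S : Set b.support) (h : H.toSubmodule ≠ ⊥) :
    0 ≤ ht b S :=
  le_csSup (bddAbove_gr b S) fun h0 ↦ h (le_bot_iff.1 (h0 ▸ cartan_le_gr_zero b S))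

lemma isAbelianIdeal_grGE (b : (rootSystem H).Base) (S : Set b.support) :
    IsAbelianIdeal b (grGE b S (ht b S / 2 + 1)) where
  le_borel := by
    by_cases h : H.toSubmodule = ⊥
    · refine iSup₂_le fun i hi ↦ iSup₂_le fun χ _ ↦ ?_
      by_cases h0 : χ.IsZero
      · intro x hx
        rw [LieSubmodule.mem_toSubmodule, h0.eq, rootSpace_zero_eq] at hx
        exact (le_sup_left : _ ≤ (borel b).toSubmodule) hx
      · refine absurd (?_ : χ.IsZero) h0
        ext z
        have hz : z = 0 := by
          have : (z : L) ∈ H.toSubmodule := z.2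
          rw [h] at this
          exact Subtype.ext (by simpa using this)
        rw [hz]
        simp
    · exact grGE_le_borel b S (by have := zero_le_ht b S h; omega)
  lie_mem := fun x hx y hy ↦
    lie_mem_of_grGE b S (borel_le_grGE b S hx) hy fun _ hi ↦ gr_le_grGE b S (by omega)
  lie_eq_zero := fun x hx y hy ↦ by
    have : ⁅x, y⁆ ∈ (⊥ : Submodule K L) :=
      lie_mem_of_grGE b S hx hy fun i hi ↦ (gr_eq_bot_of_ht_lt b S (by omega)).le
    simpa using this

/-- The map `f₂` sends `𝔭` to `𝔤(≥ [ht(𝔭) / 2] + 1)`, for the grading attached to `S(𝔭)`. -/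
def f₂ (b : (rootSystem H).Base) (p : Par b) : Ab b :=
  ⟨grGE b (simpleSet p) (ht b (simpleSet p) / 2 + 1), isAbelianIdeal_grGE b (simpleSet p)⟩

/-- The root system is of type `A_n` for some `n`. -/
def IsTypeA (b : (rootSystem H).Base) : Prop :=
  ∃ (n : ℕ) (e : b.support ≃ Fin n), b.cartanMatrix.reindex e e = CartanMatrix.A n

/-- The root system is of type `C_n` for some `n`. -/
def IsTypeC (b : (rootSystem H).Base) : Prop :=
  ∃ (n : ℕ) (e : b.support ≃ Fin n), b.cartanMatrix.reindex e e = CartanMatrix.C n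

/-- `θ` is the highest root: for every root `γ`, the difference `θ - γ` is a combination of simple
roots with coefficients in `ℕ`. -/
def IsHighestRoot (b : (rootSystem H).Base) (θ : H.root) : Prop :=
  ∀ γ : H.root, (rootSystem H).root θ - (rootSystem H).root γ ∈
    AddSubmonoid.closure ((rootSystem H).root '' b.support)

/-- The root `θ` is a fundamental weight: its pairing is `1` with one simple coroot and `0` with
the other simple coroots. -/
def IsFundamental (b : (rootSystem H).Base) (θ : H.root) : Prop :=
  ∃ i ∈ b.support, (rootSystem H).pairing θ i = 1 ∧
    ∀ j ∈ b.support, j ≠ i → (rootSystem H).pairing θ j = 0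

/-- The simple roots adjacent to the simple root `α` in the Dynkin diagram. -/
def adjacent (b : (rootSystem H).Base) (α : b.support) : Set b.support :=
  {β | β ≠ α ∧ (rootSystem H).pairing β α ≠ 0}

end

end AbelianIdeals

end

/-! Part (i) turns `f₂` into a majority rule on intervals. In type `A_n` the positive roots are the
sums of consecutive simple roots. Type `C_n` is type `A_{2n-1}` folded: its positive roots are the
sums over intervals of the palindrome α₁, …, αₙ, …, α₁. `IsIntervalModel` records both cases. The
whole sequence sums to the highest root, so for T the set of positions of members of S, the root of
an interval lies in f₂(𝔭(S)) exactly when the interval contains more than half of T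
(`rs_le_f₂_iff_card`).

Abelian ideals are determined by their positive roots (`IsAbelianIdeal.ext`), hence correspond to
families of intervals closed under enlarging and without two adjacent members. By `mem_iff_card`
such a family is the majority family of the set T of points at which a member can be shortened out
of the family; so `f₂` is surjective (`surjective_f₂`). In the other direction, every point of T is
a shortening point of the majority family of T (`exists_shortenable`). If shortening at a simple
root α leaves the ideal, then 𝔤_{-α} does not normalise it, whence `f₁ ∘ f₂ = id`
(`leftInverse_f₁_f₂`).

For part (ii) let α = α_θ. The degree for {α} is the pairing with θ^∨, and the pairing with α^∨ is
twice this degree minus the degree for S₁. So the degrees of a root γ for S₁ and S₂ are 2⟨γ,θ^∨⟩ -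
⟨γ,α^∨⟩ and 3⟨γ,θ^∨⟩ - ⟨γ,α^∨⟩. The heights are 3 and 5, the thresholds 2 and 3, and a check over
⟨γ,θ^∨⟩ = 0, 1, 2 shows that both select the same positive roots (`f₂_parOf_adjacent_eq`). -/

namespace IntervalIdeal

/-! ### Combinatorics of intervals and majorities -/

open Finset Classical in
/-- Let `I` be a set of intervals with ends in `0, …, m`, closed under enlarging and without two
adjacent members. Then `I` consists of the intervals which contain more than half of the points
at which an interval of `I` can be shortened so as to leave `I`. -/
theorem mem_iff_card {m : ℕ} {I : ℕ → ℕ → Prop} (hlt : ∀ {i j}, I i j → i < j ∧ j ≤ m)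
    (up : ∀ {i j i' j'}, I i j → i' ≤ i → j ≤ j' → j' ≤ m → I i' j')
    (ab : ∀ {i j k}, I i j → I j k → False) (T : Finset ℕ)
    (hT : ∀ k, k ∈ T ↔ (∃ j, I k j ∧ ¬ I (k + 1) j) ∨ ∃ i, I i (k + 1) ∧ ¬ I i k)
    {i j : ℕ} (hj : j ≤ m) :
    I i j ↔ #T / 2 + 1 ≤ #{k ∈ T | i ≤ k ∧ k < j} := by
  set A : Finset ℕ := {k ∈ range m | ∃ j, I k j ∧ ¬ I (k + 1) j} with hA
  set B : Finset ℕ := {k ∈ range m | ∃ i, I i (k + 1) ∧ ¬ I i k} with hB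
  -- The minimal members of `I`, recorded by first and last point; the right end is therefore `c.2 +
  -- 1`.
  set C : Finset (ℕ × ℕ) := {c ∈ range m ×ˢ range m |
    I c.1 (c.2 + 1) ∧ ¬ I (c.1 + 1) (c.2 + 1) ∧ ¬ I c.1 c.2} with hC
  have mA : ∀ k, k ∈ A ↔ ∃ j, I k j ∧ ¬ I (k + 1) j := fun k ↦ by
    simp only [hA, mem_filter, mem_range, and_iff_right_iff_imp]
    rintro ⟨j, h, -⟩
    have := hlt h
    omega
  have mB : ∀ k, k ∈ B ↔ ∃ i, I i (k + 1) ∧ ¬ I i k := fun k ↦ by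
    simp only [hB, mem_filter, mem_range, and_iff_right_iff_imp]
    rintro ⟨j, h, -⟩
    have := hlt h
    omega
  have mC : ∀ c, c ∈ C ↔ I c.1 (c.2 + 1) ∧ ¬ I (c.1 + 1) (c.2 + 1) ∧ ¬ I c.1 c.2 := fun c ↦ by
    simp only [hC, mem_filter, mem_product, mem_range, and_iff_right_iff_imp]
    rintro ⟨h, -⟩
    have := hlt h
    omega
  have hTAB : T = A ∪ B := by
    ext k
    rw [hT, mem_union, mA, mB]
  -- Minimal members do not contain one another, so the first point determines them; the shortest
  -- member beginning at a point of `A` is minimal. The same holds for `B` and last points.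
  have fA : ∀ i, #{k ∈ A | i ≤ k} = #{c ∈ C | i ≤ c.1} := fun i ↦ by
    symm
    refine card_bij (fun c _ ↦ c.1) ?_ ?_ ?_
    · intro c hc
      rw [mem_filter, mC] at hc
      rw [mem_filter, mA]
      exact ⟨⟨_, hc.1.1, hc.1.2.1⟩, hc.2⟩
    · rintro ⟨k, l⟩ hc ⟨k', l'⟩ hc' (rfl : k = k')
      rw [mem_filter, mC] at hc hc'
      have h1 := hlt hc.1.1
      have h2 := hlt hc'.1.1
      simp only at *
      rcases lt_trichotomy l l' with h | rfl | h
      · exact absurd (up hc.1.1 le_rfl (by omega) (by omega)) hc'.1.2.2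
      · rfl
      · exact absurd (up hc'.1.1 le_rfl (by omega) (by omega)) hc.1.2.2
    · intro k hk
      rw [mem_filter, mA] at hk
      obtain ⟨⟨j, h1, h2⟩, hik⟩ := hk
      have hj := hlt h1
      have hex : ∃ l, I k (l + 1) := ⟨j - 1, by rwa [Nat.sub_add_cancel (by omega)]⟩
      have hs := Nat.find_spec hex
      have hle : Nat.find hex ≤ j - 1 :=
        Nat.find_min' hex (by rwa [Nat.sub_add_cancel (by omega)])
      refine ⟨(k, Nat.find hex), ?_, rfl⟩
      rw [mem_filter, mC]
      refine ⟨⟨hs, fun h ↦ h2 (up h le_rfl (by omega) hj.2), fun h ↦ ?_⟩, hik⟩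
      have h3 := hlt h
      simp only at h h3
      exact Nat.find_min hex (m := Nat.find hex - 1) (by omega)
        (by rwa [Nat.sub_add_cancel (by omega)])
  have fB : ∀ j, #{k ∈ B | k < j} = #{c ∈ C | c.2 < j} := fun j ↦ by
    symm
    refine card_bij (fun c _ ↦ c.2) ?_ ?_ ?_
    · intro c hc
      rw [mem_filter, mC] at hc
      rw [mem_filter, mB]
      exact ⟨⟨_, hc.1.1, hc.1.2.2⟩, hc.2⟩
    · rintro ⟨k, l⟩ hc ⟨k', l'⟩ hc' (rfl : l = l')
      rw [mem_filter, mC] at hc hc'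
      have h1 := hlt hc.1.1
      have h2 := hlt hc'.1.1
      simp only at *
      rcases lt_trichotomy k k' with h | rfl | h
      · exact absurd (up hc'.1.1 (by omega) le_rfl (by omega)) hc.1.2.1
      · rfl
      · exact absurd (up hc.1.1 (by omega) le_rfl (by omega)) hc'.1.2.1
    · intro l hl
      rw [mem_filter, mB] at hl
      obtain ⟨⟨i, h1, h2⟩, hlj⟩ := hl
      have hj := hlt h1
      have hex : ∃ d, I (l - d) (l + 1) := ⟨l - i, by rwa [Nat.sub_sub_self (by omega)]⟩
      have hs := Nat.find_spec hex
      have hle : Nat.find hex ≤ l - i :=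
        Nat.find_min' hex (by rwa [Nat.sub_sub_self (by omega)])
      refine ⟨(l - Nat.find hex, l), ?_, rfl⟩
      rw [mem_filter, mC]
      refine ⟨⟨hs, fun h ↦ ?_, fun h ↦ h2 (up h (by simp only; omega) le_rfl (by omega))⟩, hlj⟩
      have h3 := hlt h
      simp only at h h3
      exact Nat.find_min hex (m := Nat.find hex - 1) (by omega)
        (by rwa [show l - (Nat.find hex - 1) = l - Nat.find hex + 1 by omega])
  have hAC : #A = #C := by simpa using fA 0
  have hBC : #B = #C := by
    have h1 := fB m
    rwa [filter_true_of_mem fun k hk ↦ mem_range.1 (mem_filter.1 hk).1,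
      filter_true_of_mem fun k hk ↦
        mem_range.1 (mem_product.1 (mem_filter.1 hk).1).2] at h1
  -- If `l < k`, the member ending with `l` could be enlarged until it is adjacent to the one
  -- beginning at `k`. Hence `A` and `B` share at most one point.
  have hle : ∀ k ∈ A, ∀ l ∈ B, k ≤ l := by
    intro k hk l hl
    obtain ⟨j, h1, -⟩ := (mA k).1 hk
    obtain ⟨i, h2, -⟩ := (mB l).1 hl
    have h3 := hlt h1
    by_contra hc
    exact ab (up h2 le_rfl (show l + 1 ≤ k by omega) (by omega)) h1
  have hcount : #{c ∈ C | i ≤ c.1} + #{c ∈ C | c.2 < j} + #{c ∈ C | c.1 < i ∧ j ≤ c.2} =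
      #C + #{c ∈ C | i ≤ c.1 ∧ c.2 < j} := by
    have e1 := card_union_add_card_inter {c ∈ C | i ≤ c.1} {c ∈ C | c.2 < j}
    rw [← filter_or, ← filter_and] at e1
    have e2 := card_filter_add_card_filter_not (s := C) (fun c ↦ i ≤ c.1 ∨ c.2 < j)
    simp only [not_or, not_le, not_lt] at e2
    omega
  have hAB1 : #(A ∩ B) ≤ 1 := by
    refine card_le_one.2 fun k hk l hl ↦ ?_
    rw [mem_inter] at hk hl
    exact le_antisymm (hle k hk.1 l hl.2) (hle l hl.1 k hk.2)
  -- Since `#(A ∩ B) ≤ 1`, the threshold `#T / 2 + 1` equals `#C + 1 - #(A ∩ B)`.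
  have hTc : #T + #(A ∩ B) = 2 * #C := by
    rw [hTAB, card_union_add_card_inter]; omega
  have hTf : #{k ∈ T | i ≤ k ∧ k < j} + #{k ∈ A ∩ B | i ≤ k ∧ k < j} =
      #{k ∈ A | i ≤ k ∧ k < j} + #{k ∈ B | i ≤ k ∧ k < j} := by
    rw [hTAB, filter_union, filter_inter_distrib, card_union_add_card_inter]
  have hA' : #{k ∈ A | i ≤ k ∧ k < j} ≤ #{k ∈ A | i ≤ k} :=
    card_le_card (monotone_filter_right _ fun k _ h ↦ h.1)
  have hB' : #{k ∈ B | i ≤ k ∧ k < j} ≤ #{k ∈ B | k < j} :=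
    card_le_card (monotone_filter_right _ fun k _ h ↦ h.2)
  rw [fA] at hA'
  rw [fB] at hB'
  constructor
  · intro h
    have hij := hlt h
    have eA : #{k ∈ A | i ≤ k ∧ k < j} = #{c ∈ C | i ≤ c.1} := by
      rw [← fA]
      congr 1
      refine filter_congr fun k hk ↦ and_iff_left_of_imp fun hik ↦ ?_
      obtain ⟨j', h1, -⟩ := (mA k).1 hk
      by_contra hc
      exact ab (up h le_rfl (show j ≤ k by omega) (by have := hlt h1; omega)) h1
    have eB : #{k ∈ B | i ≤ k ∧ k < j} = #{c ∈ C | c.2 < j} := by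
      rw [← fB]
      congr 1
      refine filter_congr fun k hk ↦ and_iff_right_of_imp fun hik ↦ ?_
      obtain ⟨i', h1, -⟩ := (mB k).1 hk
      by_contra hc
      exact ab h1 (up h (show k + 1 ≤ i by omega) le_rfl hj)
    have e0 : #{c ∈ C | c.1 < i ∧ j ≤ c.2} = 0 := by
      rw [card_eq_zero, filter_eq_empty_iff]
      rintro c hc ⟨h1, h2⟩
      rw [mC] at hc
      exact hc.2.1 (up h (by omega) (by omega) (hlt hc.1).2)
    -- Shorten the given member from the left as far as possible, then from the right: the result is
    -- minimal.
    have e1 : 1 ≤ #{c ∈ C | i ≤ c.1 ∧ c.2 < j} := by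
      have hex : ∃ d, I (j - 1 - d) j := ⟨j - 1 - i, by rwa [Nat.sub_sub_self (by omega)]⟩
      have hs := Nat.find_spec hex
      have hd : Nat.find hex ≤ j - 1 - i :=
        Nat.find_min' hex (by rwa [Nat.sub_sub_self (by omega)])
      set k := j - 1 - Nat.find hex with hk
      have hex' : ∃ l, I k (l + 1) := ⟨j - 1, by rwa [Nat.sub_add_cancel (by omega)]⟩
      have hs' := Nat.find_spec hex'
      have hl : Nat.find hex' ≤ j - 1 :=
        Nat.find_min' hex' (by rwa [Nat.sub_add_cancel (by omega)])
      refine card_pos.2 ⟨(k, Nat.find hex'), ?_⟩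
      rw [mem_filter, mC]
      refine ⟨⟨hs', fun h3 ↦ ?_, fun h3 ↦ ?_⟩, by simp only; omega, by simp only; omega⟩
      · have h4 : I (k + 1) j := up h3 le_rfl (by simp only; omega) hj
        have h5 := hlt h4
        exact Nat.find_min hex (m := Nat.find hex - 1) (by omega)
          (by rwa [show j - 1 - (Nat.find hex - 1) = k + 1 by omega])
      · have h4 := hlt h3
        simp only at h3 h4
        exact Nat.find_min hex' (m := Nat.find hex' - 1) (by omega)
          (by rwa [Nat.sub_add_cancel (by omega)])
    have e2 : #{k ∈ A ∩ B | i ≤ k ∧ k < j} ≤ #(A ∩ B) := card_filter_le _ _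
    omega
  · intro h
    by_contra hI
    have e1 : #{c ∈ C | i ≤ c.1 ∧ c.2 < j} = 0 := by
      rw [card_eq_zero, filter_eq_empty_iff]
      rintro c hc ⟨h1, h2⟩
      rw [mC] at hc
      exact hI (up hc.1 (by omega) (by omega) hj)
    rcases Nat.le_one_iff_eq_zero_or_eq_one.1 hAB1 with h0 | h1
    · omega
    obtain ⟨t, ht⟩ := card_eq_one.1 h1
    have htAB : t ∈ A ∩ B := by rw [ht]; exact mem_singleton_self t
    have htA := (mem_inter.1 htAB).1
    have htB := (mem_inter.1 htAB).2
    by_cases hti : i ≤ t ∧ t < j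
    · have : #{k ∈ A ∩ B | i ≤ k ∧ k < j} = 1 := by
        rw [ht, filter_singleton, if_pos hti, card_singleton]
      omega
    -- The common point `t` lies outside the interval. As `A` lies to its left and `B` to its right,
    -- one of the two counts vanishes and the other misses `t`, so the total is at most `#C - 1`.
    have hA2 := card_erase_of_mem htA
    have hB2 := card_erase_of_mem htB
    have hA3 : #{k ∈ A | i ≤ k ∧ k < j} ≤ #(A.erase t) := card_le_card fun k hk ↦ by
      rw [mem_filter] at hk
      refine mem_erase.2 ⟨?_, hk.1⟩
      rintro rfl
      exact hti hk.2
    have hB3 : #{k ∈ B | i ≤ k ∧ k < j} ≤ #(B.erase t) := card_le_card fun k hk ↦ by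
      rw [mem_filter] at hk
      refine mem_erase.2 ⟨?_, hk.1⟩
      rintro rfl
      exact hti hk.2
    have hCpos : 1 ≤ #C := by rw [← hAC]; exact card_pos.2 ⟨t, htA⟩
    rcases lt_or_ge t i with h2 | h2
    · have : #{k ∈ A | i ≤ k ∧ k < j} = 0 := by
        rw [card_eq_zero, filter_eq_empty_iff]
        rintro k hk ⟨h3, -⟩
        have := hle k hk t htB
        omega
      omega
    · have : #{k ∈ B | i ≤ k ∧ k < j} = 0 := by
        rw [card_eq_zero, filter_eq_empty_iff]
        rintro k hk ⟨h3, h4⟩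
        have := hle t htA k hk
        omega
      omega

open Finset in
/-- At each point of `T` begins or ends an interval which contains more than half of `T`, but no
longer does so when that point is removed. -/
theorem exists_shortenable {m : ℕ} {T : Finset ℕ} (hT : ∀ k ∈ T, k < m) {k : ℕ} (hk : k ∈ T) :
    (∃ j, k < j ∧ j ≤ m ∧ #T / 2 + 1 ≤ #{l ∈ T | k ≤ l ∧ l < j} ∧
      #{l ∈ T | k + 1 ≤ l ∧ l < j} < #T / 2 + 1) ∨
    ∃ i, i ≤ k ∧ #T / 2 + 1 ≤ #{l ∈ T | i ≤ l ∧ l < k + 1} ∧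
      #{l ∈ T | i ≤ l ∧ l < k} < #T / 2 + 1 := by
  have hsplit := card_filter_add_card_filter_not (s := T) (fun l ↦ k ≤ l)
  simp only [not_le] at hsplit
  have hkm := hT k hk
  have hins : ∀ i j, i ≤ j → #{l ∈ T | i ≤ l ∧ l < j + 1} ≤ #{l ∈ T | i ≤ l ∧ l < j} + 1 := by
    intro i j hij
    refine (card_le_card (t := insert j {l ∈ T | i ≤ l ∧ l < j}) fun l hl ↦ ?_).trans
      (card_insert_le _ _)
    rw [mem_filter] at hl
    rw [mem_insert, mem_filter]
    by_cases h : l = j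
    · exact Or.inl h
    · exact Or.inr ⟨hl.1, hl.2.1, by omega⟩
  -- Either the points from `k` on form a majority, or, because `k` itself is in `T`, those up to
  -- `k` do. In each case a shortest interval reaching the threshold meets it exactly, so dropping
  -- `k` falls below it.
  by_cases hc : #T / 2 + 1 ≤ #{l ∈ T | k ≤ l}
  · left
    have hex : ∃ d, #T / 2 + 1 ≤ #{l ∈ T | k ≤ l ∧ l < k + d} := by
      refine ⟨m - k, hc.trans (card_le_card fun l hl ↦ ?_)⟩
      rw [mem_filter] at hl ⊢
      have := hT l hl.1
      exact ⟨hl.1, hl.2, by omega⟩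
    have hs := Nat.find_spec hex
    set d := Nat.find hex with hd
    have hd0 : d ≠ 0 := by
      intro h0
      rw [h0, filter_false_of_mem fun l _ ↦ by omega, card_empty] at hs
      omega
    have hdm : d ≤ m - k := Nat.find_min' hex (hc.trans (card_le_card fun l hl ↦ by
      rw [mem_filter] at hl ⊢
      have := hT l hl.1
      exact ⟨hl.1, hl.2, by omega⟩))
    have hmin := Nat.find_min hex (m := d - 1) (by omega)
    refine ⟨k + d, by omega, by omega, hs, ?_⟩
    have h1 := hins k (k + (d - 1)) (by omega)
    rw [show k + (d - 1) + 1 = k + d by omega] at h1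
    have h2 : #{l ∈ T | k + 1 ≤ l ∧ l < k + d} + 1 ≤ #{l ∈ T | k ≤ l ∧ l < k + d} := by
      rw [Nat.succ_le_iff]
      refine card_lt_card (ssubset_iff_of_subset (monotone_filter_right _ fun l _ hl ↦
        ⟨by omega, hl.2⟩) |>.2 ⟨k, ?_, ?_⟩)
      · exact mem_filter.2 ⟨hk, le_rfl, by omega⟩
      · simp
    omega
  · right
    have hlt : #{l ∈ T | l < k} + 1 ≤ #{l ∈ T | l < k + 1} := by
      rw [Nat.succ_le_iff]
      refine card_lt_card (ssubset_iff_of_subset (monotone_filter_right _ fun l _ hl ↦ by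
        omega) |>.2 ⟨k, ?_, ?_⟩)
      · exact mem_filter.2 ⟨hk, by omega⟩
      · simp
    have h0 : #T / 2 + 1 ≤ #{l ∈ T | 0 ≤ l ∧ l < k + 1} := by
      simp only [Nat.zero_le, true_and]
      omega
    obtain ⟨i, hi, hi'⟩ : ∃ i, #T / 2 + 1 ≤ #{l ∈ T | i ≤ l ∧ l < k + 1} ∧
        ¬ #T / 2 + 1 ≤ #{l ∈ T | i + 1 ≤ l ∧ l < k + 1} := by
      by_contra! hcon
      have : ∀ i, #T / 2 + 1 ≤ #{l ∈ T | i ≤ l ∧ l < k + 1} := fun i ↦ by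
        induction i with
        | zero => exact h0
        | succ i ih => exact hcon i ih
      have h1 := this (k + 1)
      rw [filter_false_of_mem fun l _ ↦ by omega, card_empty] at h1
      omega
    have hik : i ≤ k := by
      by_contra h
      rw [filter_false_of_mem fun l _ ↦ by omega, card_empty] at hi
      omega
    refine ⟨i, hik, hi, ?_⟩
    have h1 : #{l ∈ T | i ≤ l ∧ l < k + 1} ≤ #{l ∈ T | i + 1 ≤ l ∧ l < k + 1} + 1 := by
      refine (card_le_card (t := insert i {l ∈ T | i + 1 ≤ l ∧ l < k + 1}) fun l hl ↦ ?_).trans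
        (card_insert_le _ _)
      rw [mem_filter] at hl
      rw [mem_insert, mem_filter]
      by_cases h : l = i
      · exact Or.inl h
      · exact Or.inr ⟨hl.1, by omega, hl.2.2⟩
    have h2 : #{l ∈ T | i ≤ l ∧ l < k} + 1 ≤ #{l ∈ T | i ≤ l ∧ l < k + 1} := by
      rw [Nat.succ_le_iff]
      refine card_lt_card (ssubset_iff_of_subset (monotone_filter_right _ fun l _ hl ↦
        ⟨hl.1, by omega⟩) |>.2 ⟨k, ?_, ?_⟩)
      · exact mem_filter.2 ⟨hk, hik, by omega⟩
      · simp
    omega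

end IntervalIdeal

/-! ### Positive roots of types A and C as intervals -/

namespace RootPairing.Base

open Finset Module

variable {ι R M N : Type*} [CommRing R] [AddCommGroup M] [Module R M] [AddCommGroup N] [Module R N]
  {P : RootPairing ι R M N}

/-- The sum of the simple roots `α_{σ k}` over the interval `i ≤ k < j`. -/
def intervalSum (b : P.Base) (σ : ℕ → b.support) (i j : ℕ) : M :=
  ∑ k ∈ Ico i j, P.root (σ k)

lemma intervalSum_succ_right (b : P.Base) (σ : ℕ → b.support) {i j : ℕ} (h : i ≤ j) :
    b.intervalSum σ i (j + 1) = b.intervalSum σ i j + P.root (σ j) :=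
  sum_Ico_succ_top h _

lemma intervalSum_succ_left (b : P.Base) (σ : ℕ → b.support) {i j : ℕ} (h : i < j) :
    b.intervalSum σ i j = P.root (σ i) + b.intervalSum σ (i + 1) j :=
  sum_eq_sum_Ico_succ_bot h _

lemma intervalSum_add (b : P.Base) (σ : ℕ → b.support) {i j k : ℕ} (h : i ≤ j) (h' : j ≤ k) :
    b.intervalSum σ i k = b.intervalSum σ i j + b.intervalSum σ j k :=
  (sum_Ico_consecutive _ h h').symm

lemma intervalSum_eq_sub (b : P.Base) (σ : ℕ → b.support) {i j : ℕ} (h : i ≤ j) :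
    b.intervalSum σ i j = b.intervalSum σ 0 j - b.intervalSum σ 0 i := by
  rw [intervalSum_add b σ (Nat.zero_le i) h]; abel

/-- The positive roots are the sums of simple roots over the subintervals of a finite sequence of
simple roots, in which every simple root occurs, either once or, if the sequence is a palindrome,
at two symmetric positions. -/
structure IsIntervalModel [CharZero R] (b : P.Base) (m : ℕ) (σ : ℕ → b.support) : Prop where
  exists_root : ∀ {i j : ℕ}, i < j → j ≤ m → ∃ γ, b.IsPos γ ∧ P.root γ = b.intervalSum σ i j
  exists_interval : ∀ γ, b.IsPos γ → ∃ i j, i < j ∧ j ≤ m ∧ P.root γ = b.intervalSum σ i j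
  surj : ∀ s, ∃ k < m, σ k = s
  fold : ∀ k < m, ∀ l < m, σ k = σ l → k = l ∨
    (k + l + 1 = m ∧ ∀ i < m, σ (m - 1 - i) = σ i)

/-- The entries of the Cartan matrix of type `A`. -/
def typeAEntry (i t : ℕ) : ℤ :=
  if i = t then 2 else if i + 1 = t ∨ t + 1 = i then -1 else 0

/-- The partial sums of `typeAEntry`, up to a constant. -/
def typeAPartial (t x : ℕ) : ℤ :=
  if x = t then -1 else if x = t + 1 then 1 else 0

lemma typeAPartial_succ_sub (t x : ℕ) :
    typeAPartial t (x + 1) - typeAPartial t x = typeAEntry x t := by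
  unfold typeAPartial typeAEntry
  split_ifs <;> omega

section

variable [Finite ι] [CharZero R] [IsDomain R] [P.IsCrystallographic] [P.IsReduced]

omit [P.IsReduced] [Finite ι] [IsDomain R] [P.IsCrystallographic] in
lemma root_ne_neg_of_isPos {b : P.Base} {γ i : ι} (hγ : b.IsPos γ) (hi : b.IsPos i) :
    P.root γ ≠ -P.root i := by
  intro h
  have h1 : P.root γ = P.root (P.reflectionPerm i i) := by
    rw [h, P.root_reflectionPerm, P.reflection_apply_self]
  have h2 : b.height (P.reflectionPerm i i) = -b.height i := b.height_reflectionPerm_self i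
  rw [← P.root.injective h1] at h2
  rw [isPos_iff] at hγ hi
  omega

variable {b : P.Base} {m : ℕ} {σ : ℕ → b.support} {τ : ℕ → ℕ}

/-- The partial sums of the column `σ t` of the Cartan matrix, up to a constant. -/
def foldedPartial (τ : ℕ → ℕ) (t x : ℕ) : ℤ :=
  typeAPartial t x + if τ t = t then 0 else typeAPartial (τ t) x

/-- The Cartan matrix entries along `σ` are those of type `A`, folded by `τ`. -/
structure IsFolded (b : P.Base) (m : ℕ) (σ : ℕ → b.support) (τ : ℕ → ℕ) : Prop where
  invol : ∀ t < m, τ t < m ∧ σ (τ t) = σ t ∧ τ t ≠ t + 1 ∧ t ≠ τ t + 1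
  pairing : ∀ i < m, ∀ t < m, P.pairingIn ℤ (σ i) (σ t) =
      typeAEntry i t + if τ t = t then 0 else typeAEntry i (τ t)

namespace IsFolded

variable (h : IsFolded b m σ τ)
include h

omit [P.IsReduced] [Finite ι] [IsDomain R] [CharZero R] in
lemma pairing_eq {i t : ℕ} (hi : i < m) (ht : t < m) : P.pairing (σ i) (σ t) =
    ((foldedPartial τ t (i + 1) - foldedPartial τ t i : ℤ) : R) := by
  rw [← P.algebraMap_pairingIn ℤ, h.pairing i hi t ht, foldedPartial, foldedPartial,
    ← typeAPartial_succ_sub, ← typeAPartial_succ_sub, eq_intCast]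
  congr 1
  split_ifs <;> ring

omit [P.IsReduced] [Finite ι] [IsDomain R] [CharZero R] in
lemma coroot_intervalSum {t i j : ℕ} (ht : t < m) (hij : i ≤ j) (hj : j ≤ m) :
    P.coroot' (σ t) (b.intervalSum σ i j) =
      ((foldedPartial τ t j - foldedPartial τ t i : ℤ) : R) := by
  induction j, hij using Nat.le_induction with
  | base => simp [intervalSum]
  | succ j hij ih =>
    rw [intervalSum_succ_right b σ hij, map_add, ih (by omega), P.root_coroot'_eq_pairing,
      h.pairing_eq (by omega) ht]
    push_cast
    ring

/-- Simple roots are appended on the right one at a time: a negative pairing with the next simple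
coroot makes the sum a root. This fails only when both ends of the interval carry the same simple
root. -/
lemma exists_root_eq_intervalSum {i j : ℕ} (hij : i < j)
    (hj : j ≤ m) : ∃ γ, b.IsPos γ ∧ P.root γ = b.intervalSum σ i j := by
  induction j generalizing i with
  | zero => omega
  | succ j ih =>
    have hjm : b.IsPos (σ j) := isPos_of_mem_support (σ j).2
    rcases Nat.lt_or_ge i j with hlt | hge
    swap
    · obtain rfl : i = j := by omega
      exact ⟨σ i, hjm, by simp [intervalSum]⟩
    obtain ⟨t1, t2, t3, t4⟩ := h.invol j (by omega)
    -- Here the pairing of the interval `i, …, j - 1` with the coroot of `σ j` is zero. The inner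
    -- interval pairs to `-2` instead, and reflecting it adds the simple root at both ends at once.
    by_cases hi : i = τ j
    · have h1 : i + 1 < j := by omega
      obtain ⟨γ, hγ, e⟩ := ih h1 (by omega)
      have hc := h.coroot_intervalSum (t := j) (by omega) h1.le (by omega)
      have hv : foldedPartial τ j j - foldedPartial τ j (i + 1) = -2 := by
        unfold foldedPartial typeAPartial
        split_ifs <;> omega
      have e2 : P.root (P.reflectionPerm (σ j) γ) = b.intervalSum σ i (j + 1) := by
        rw [P.root_reflectionPerm, P.reflection_apply, e, hc, hv,
          intervalSum_succ_right b σ hlt.le, intervalSum_succ_left b σ hlt, hi, t2]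
        push_cast
        module
      refine ⟨_, hγ.reflectionPerm (σ j).2 ?_, e2⟩
      rintro rfl
      rw [← e, P.root_coroot'_eq_pairing, P.pairing_same, hv] at hc
      norm_num at hc
    · obtain ⟨γ, hγ, e⟩ := ih hlt (by omega)
      have hc := h.coroot_intervalSum (t := j) (by omega) hlt.le (by omega)
      rw [← e, P.root_coroot'_eq_pairing, ← P.algebraMap_pairingIn ℤ] at hc
      have hc' : P.pairingIn ℤ γ (σ j) = foldedPartial τ j j - foldedPartial τ j i :=
        Int.cast_injective (α := R) (by simpa using hc)
      have hv : foldedPartial τ j j - foldedPartial τ j i < 0 := by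
        unfold foldedPartial typeAPartial
        split_ifs <;> omega
      obtain ⟨δ, hδ⟩ := P.root_add_root_mem_of_pairingIn_neg (i := γ) (j := σ j)
        (by rw [hc']; exact hv) (root_ne_neg_of_isPos hγ hjm)
      exact ⟨δ, hγ.add hjm hδ, by rw [hδ, e, intervalSum_succ_right b σ hlt.le]⟩

-- The sums over initial segments behave like the coordinates ε_x of type `A`: up to a common
-- translation, which cancels in differences, a simple reflection swaps those at `t` and `t + 1`,
-- and those at `τ t` and `τ t + 1`.
omit [P.IsReduced] [Finite ι] [IsDomain R] [CharZero R] in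
lemma reflection_intervalSum {t : ℕ} (ht : t < m) : ∃ π : ℕ → ℕ, (∀ x ≤ m, π x ≤ m) ∧
    ∀ x ≤ m, ∀ y ≤ m,
      P.reflection (σ t) (b.intervalSum σ 0 y - b.intervalSum σ 0 x) =
        b.intervalSum σ 0 (π y) - b.intervalSum σ 0 (π x) := by
  obtain ⟨t1, t2, t3, t4⟩ := h.invol t ht
  set π : ℕ → ℕ := fun x ↦ if x = t then t + 1 else if x = t + 1 then t else
    if x = τ t then τ t + 1 else if x = τ t + 1 then τ t else x with hπ
  have key : ∀ x, b.intervalSum σ 0 (π x) - b.intervalSum σ 0 x =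
      -(foldedPartial τ t x) • P.root (σ t) := by
    intro x
    have h1 := b.intervalSum_succ_right σ (Nat.zero_le t)
    have h2 := b.intervalSum_succ_right σ (Nat.zero_le (τ t))
    rw [t2] at h2
    unfold foldedPartial typeAPartial
    simp only [hπ]
    split_ifs <;> first | omega | (subst_vars; simp_all)
  refine ⟨π, fun x hx ↦ by simp only [hπ]; split_ifs <;> omega, fun x hx y hy ↦ ?_⟩
  have c : ∀ x ≤ m, P.coroot' (σ t) (b.intervalSum σ 0 x) =
      ((foldedPartial τ t x - foldedPartial τ t 0 : ℤ) : R) := fun x hx ↦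
    h.coroot_intervalSum ht (Nat.zero_le x) hx
  have hx' := key x
  have hy' := key y
  rw [sub_eq_iff_eq_add] at hx' hy'
  rw [P.reflection_apply, map_sub, c x hx, c y hy, hx', hy', ← Int.cast_sub,
    Int.cast_smul_eq_zsmul]
  module

/-- Differences of initial sums contain the simple roots and are stable under negation and simple
reflections, so they exhaust the roots. Positivity then orders the two ends. -/
lemma exists_intervalSum_eq_root (hs : ∀ s, ∃ k < m, σ k = s) {γ : ι} (hγ : b.IsPos γ) :
    ∃ i j, i < j ∧ j ≤ m ∧ P.root γ = b.intervalSum σ i j := by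
  obtain ⟨x, y, hx, hy, e⟩ : ∃ x y, x ≤ m ∧ y ≤ m ∧
      P.root γ = b.intervalSum σ 0 y - b.intervalSum σ 0 x := by
    refine b.induction_reflect γ (p := fun γ ↦ ∃ x y, x ≤ m ∧ y ≤ m ∧
      P.root γ = b.intervalSum σ 0 y - b.intervalSum σ 0 x) ?_ ?_ ?_
    · rintro γ ⟨x, y, hx, hy, e⟩
      exact ⟨y, x, hy, hx, by rw [P.root_reflectionPerm, P.reflection_apply_self, e, neg_sub]⟩
    · intro s hs'
      obtain ⟨k, hk, e⟩ := hs ⟨s, hs'⟩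
      exact ⟨k, k + 1, hk.le, hk, by rw [intervalSum_succ_right b σ (Nat.zero_le k), e]; simp⟩
    · rintro γ s ⟨x, y, hx, hy, e⟩ hs'
      obtain ⟨k, hk, e'⟩ := hs ⟨s, hs'⟩
      obtain ⟨π, h1, h2⟩ := h.reflection_intervalSum hk
      rw [e'] at h2
      exact ⟨π x, π y, h1 x hx, h1 y hy, by rw [P.root_reflectionPerm, e, h2 x hx y hy]⟩
  rcases lt_trichotomy x y with hlt | rfl | hlt
  · exact ⟨x, y, hlt, hy, by rw [e, intervalSum_eq_sub b σ hlt.le]⟩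
  · rw [sub_self] at e
    exact absurd e (P.ne_zero γ)
  · obtain ⟨δ, hδ, e'⟩ := h.exists_root_eq_intervalSum hlt hx
    rw [intervalSum_eq_sub b σ hlt.le] at e'
    exact absurd (by rw [e, e', neg_sub]) (root_ne_neg_of_isPos hγ hδ)

lemma isIntervalModel (hs : ∀ s, ∃ k < m, σ k = s)
    (hfold : ∀ k < m, ∀ l < m, σ k = σ l → k = l ∨
      (k + l + 1 = m ∧ ∀ i < m, σ (m - 1 - i) = σ i)) : b.IsIntervalModel m σ where
  exists_root := h.exists_root_eq_intervalSum
  exists_interval _ := h.exists_intervalSum_eq_root hs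
  surj := hs
  fold := hfold

end IsFolded

lemma exists_isIntervalModel_of_typeA [Nonempty b.support] {n : ℕ} (e : b.support ≃ Fin n)
    (he : b.cartanMatrix.reindex e e = CartanMatrix.A n) :
    ∃ m σ, b.IsIntervalModel m σ := by
  classical
  set σ : ℕ → b.support := fun k ↦ if h : k < n then e.symm ⟨k, h⟩ else Classical.arbitrary _
    with hσ
  have hσ' : ∀ k (hk : k < n), σ k = e.symm ⟨k, hk⟩ := fun k hk ↦ by simp [hσ, hk]
  refine ⟨n, σ, IsFolded.isIntervalModel (τ := id) ⟨fun t ht ↦ ⟨ht, rfl, by simp, by simp⟩,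
    fun i hi t ht ↦ ?_⟩ (fun s ↦ ⟨e s, (e s).2, by simp [hσ']⟩) fun k hk l hl h ↦ Or.inl ?_⟩
  · have h1 := congrFun (congrFun he ⟨i, hi⟩) ⟨t, ht⟩
    rw [Matrix.reindex_apply, Matrix.submatrix_apply, ← hσ' i hi, ← hσ' t ht] at h1
    refine h1.trans ?_
    simp [CartanMatrix.A, typeAEntry]
  · rw [hσ' k hk, hσ' l hl] at h
    simpa using h

/-- The palindrome 0, …, n - 1, …, 0 has length `2 * n - 1`; its middle term is the fixed point of
the folding. -/
lemma exists_isIntervalModel_of_typeC [Nonempty b.support] {n : ℕ} (e : b.support ≃ Fin n)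
    (he : b.cartanMatrix.reindex e e = CartanMatrix.C n) :
    ∃ m σ, b.IsIntervalModel m σ := by
  have hn : 0 < n := (e (Classical.arbitrary _)).pos
  set σ : ℕ → b.support := fun k ↦ e.symm ⟨min k (2 * n - 2 - k), by omega⟩ with hσ
  refine ⟨2 * n - 1, σ, IsFolded.isIntervalModel (τ := fun t ↦ 2 * n - 2 - t)
    ⟨fun t ht ↦ ⟨by omega, ?_, by omega, by omega⟩,
    fun i hi t ht ↦ ?_⟩ (fun s ↦ ⟨e s, by omega, ?_⟩) fun k hk l hl h ↦ ?_⟩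
  · simp only [hσ]
    congr 2
    omega
  · have h1 := congrFun (congrFun he ⟨min i (2 * n - 2 - i), by omega⟩)
      ⟨min t (2 * n - 2 - t), by omega⟩
    rw [Matrix.reindex_apply, Matrix.submatrix_apply] at h1
    refine h1.trans ?_
    simp only [CartanMatrix.C, typeAEntry, Matrix.of_apply, Fin.mk.injEq]
    split_ifs <;> omega
  · have := (e s).2
    simp only [hσ]
    rw [Equiv.symm_apply_eq]
    ext
    simp only
    omega
  · simp only [hσ, EmbeddingLike.apply_eq_iff_eq, Fin.mk.injEq] at h
    by_cases hkl : k = l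
    · exact Or.inl hkl
    refine Or.inr ⟨by omega, fun i hi ↦ ?_⟩
    simp only [hσ]
    congr 2
    omega

end

end RootPairing.Base

/-! ### Root spaces, abelian ideals and standard parabolics -/

noncomputable section

namespace AbelianIdeals

open LieAlgebra LieAlgebra.IsKilling LieModule Module

variable {K L : Type*} [Field K] [CharZero K] [LieRing L] [LieAlgebra K L]
  [FiniteDimensional K L] [IsKilling K L]
  {H : LieSubalgebra K L} [H.IsCartanSubalgebra] [IsTriangularizable K H L]

/-- The root space of a root. -/
abbrev rs (γ : H.root) : Submodule K L := (rootSpace H (γ : Weight K H L)).toSubmodule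

omit [CharZero K] [IsKilling K L] [IsTriangularizable K H L] in
lemma mem_rs_iff {γ : H.root} {x : L} : x ∈ rs γ ↔ x ∈ rootSpace H (γ : Weight K H L) := Iff.rfl

/-- The negative of a root. -/
def negRoot (γ : H.root) : H.root := (rootSystem H).reflectionPerm γ γ

lemma root_negRoot (γ : H.root) :
    (rootSystem H).root (negRoot γ) = -(rootSystem H).root γ :=
  ((rootSystem H).root_reflectionPerm γ γ).trans ((rootSystem H).reflection_apply_self γ)

lemma coe_negRoot (γ : H.root) :
    ((negRoot γ : H.root) : Weight K H L) = -(γ : Weight K H L) := by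
  have h := root_negRoot γ
  ext x
  simpa using LinearMap.congr_fun h x

lemma negRoot_negRoot (γ : H.root) : negRoot (negRoot γ) = γ := by
  apply (rootSystem H).root.injective
  rw [root_negRoot, root_negRoot, neg_neg]

lemma isPos_or_negRoot (b : (rootSystem H).Base) (γ : H.root) :
    b.IsPos γ ∨ b.IsPos (negRoot γ) :=
  RootPairing.Base.IsPos.or_neg b γ

omit [CharZero K] [IsKilling K L] [IsTriangularizable K H L] in
lemma exists_ne_zero_mem_rs (γ : H.root) : ∃ x ∈ rs γ, x ≠ 0 :=
  (γ : Weight K H L).exists_ne_zero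

lemma le_of_mem_of_ne_zero {γ : H.root} {x : L} (hx : x ∈ rs γ) (h0 : x ≠ 0) {W : Submodule K L}
    (hW : x ∈ W) : rs γ ≤ W := by
  intro y hy
  have h1 := finrank_rootSpace_eq_one (γ : Weight K H L) (H.isNonZero_coe_root γ)
  obtain ⟨c, hc⟩ := (finrank_eq_one_iff_of_nonzero' (⟨x, hx⟩ : rootSpace H (γ : Weight K H L))
    (fun h ↦ h0 (congrArg Subtype.val h))).1 h1 ⟨y, hy⟩
  have : c • x = y := congrArg Subtype.val hc
  rw [← this]
  exact W.smul_mem c hW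

lemma lie_eq_smul {γ : H.root} {x : L} (hx : x ∈ rs γ) (h : H) :
    ⁅(h : L), x⁆ = (γ : Weight K H L) h • x :=
  lie_eq_smul_of_mem_rootSpace (α := ((γ : Weight K H L) : H → K)) hx h

/-- The bracket of nonzero vectors of two root spaces is nonzero if the sum is a root. -/
lemma lie_ne_zero {α β φ : H.root}
    (h : (rootSystem H).root φ = (rootSystem H).root α + (rootSystem H).root β)
    {x y : L} (hx : x ∈ rs α) (hy : y ∈ rs β) (hx0 : x ≠ 0) (hy0 : y ≠ 0) : ⁅x, y⁆ ≠ 0 := by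
  have hα := H.isNonZero_coe_root α
  obtain ⟨t, e, f, isSl2, he, hf⟩ := exists_isSl2Triple_of_weight_isNonZero hα
  obtain rfl := isSl2.h_eq_coroot hα he hf
  obtain ⟨v, hv, hv0⟩ := (chainTop (α : Weight K H L) (β : Weight K H L)).exists_ne_zero
  have prim : isSl2.HasPrimitiveVectorWith v
      (chainLength (α : Weight K H L) (β : Weight K H L) : K) :=
    have := lie_mem_genWeightSpace_of_mem_genWeightSpace he hv
    ⟨hv0, (chainLength_smul _ _ hv).symm, by rwa [genWeightSpace_add_chainTop _ _ hα] at this⟩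
  have hle := chainTopCoeff_le_chainLength (α : Weight K H L) (β : Weight K H L)
  have hφ : ((φ : Weight K H L) : H → K) = (α : Weight K H L) + (β : Weight K H L) := by
    ext z
    simpa using LinearMap.congr_fun h z
  -- As α + β is a root, β is not the top of its α-chain. Lowering the top vector `p + 1` times
  -- reaches 𝔤_β, and `e` then gives a nonzero multiple of the previous vector. Root spaces being
  -- lines, this decides the bracket of `x` and `y`.
  obtain ⟨p, hp⟩ : ∃ p, chainTopCoeff (α : Weight K H L) (β : Weight K H L) = p + 1 := by
    refine Nat.exists_eq_succ_of_ne_zero fun h0 ↦ (φ : Weight K H L).2 ?_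
    have := genWeightSpace_chainTopCoeff_add_one_nsmul_add (α : Weight K H L) (β : Weight K H L) hα
    rwa [h0, zero_add, one_smul, ← hφ] at this
  have hw : (toEnd K L L f ^ (p + 1)) v ∈ rs β := by
    have := toEnd_pow_apply_mem hf hv (p + 1)
    rwa [coe_chainTop', hp, smul_neg, neg_add_cancel_left] at this
  have hev : ⁅e, (toEnd K L L f ^ (p + 1)) v⁆ ≠ 0 := by
    rw [prim.lie_e_pow_succ_toEnd_f]
    refine smul_ne_zero (mul_ne_zero (Nat.cast_add_one_ne_zero p) ?_)
      (prim.pow_toEnd_f_ne_zero_of_eq_nat rfl (by omega))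
    rw [sub_ne_zero, Ne, Nat.cast_inj]
    omega
  intro h0
  obtain ⟨c, rfl⟩ := Submodule.mem_span_singleton.1
    (le_of_mem_of_ne_zero hx hx0 (Submodule.mem_span_singleton_self x) he)
  obtain ⟨d, hd⟩ := Submodule.mem_span_singleton.1
    (le_of_mem_of_ne_zero hy hy0 (Submodule.mem_span_singleton_self y) hw)
  rw [← hd, smul_lie, lie_smul, h0, smul_zero, smul_zero] at hev
  exact hev rfl

lemma lie_mem_rs {α β φ : H.root}
    (h : (rootSystem H).root φ = (rootSystem H).root α + (rootSystem H).root β)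
    {x y : L} (hx : x ∈ rs α) (hy : y ∈ rs β) : ⁅x, y⁆ ∈ rs φ := by
  have h1 := lie_mem_genWeightSpace_of_mem_genWeightSpace hx hy
  have : ((φ : Weight K H L) : H → K) = (α : Weight K H L) + (β : Weight K H L) := by
    ext z
    simpa using LinearMap.congr_fun h z
  rw [mem_rs_iff, rootSpace, this]
  exact h1

lemma rs_le_of_add {α β φ : H.root}
    (h : (rootSystem H).root φ = (rootSystem H).root α + (rootSystem H).root β)
    {W : Submodule K L} (hW : ∀ x ∈ rs α, ∀ y ∈ rs β, ⁅x, y⁆ ∈ W) : rs φ ≤ W := by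
  obtain ⟨x, hx, hx0⟩ := exists_ne_zero_mem_rs α
  obtain ⟨y, hy, hy0⟩ := exists_ne_zero_mem_rs β
  exact le_of_mem_of_ne_zero (lie_mem_rs h hx hy) (lie_ne_zero h hx hy hx0 hy0) (hW x hx y hy)

lemma exists_lie_negRoot (γ : H.root) :
    ∃ e ∈ rs γ, ∃ f ∈ rs (negRoot γ), ⁅e, f⁆ ∈ H ∧ ⁅e, f⁆ ≠ 0 := by
  have hγ := H.isNonZero_coe_root γ
  obtain ⟨h, e, f, t, he, hf⟩ := exists_isSl2Triple_of_weight_isNonZero hγ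
  refine ⟨e, he, f, ?_, ?_, ?_⟩
  · rw [mem_rs_iff, coe_negRoot, Weight.coe_neg]
    exact hf
  · rw [t.lie_e_f, t.h_eq_coroot hγ he hf]
    exact Subtype.property _
  · rw [t.lie_e_f]
    exact t.h_ne_zero

/-- A subspace which is stable under the Cartan subalgebra. -/
def IsStable (H : LieSubalgebra K L) (W : Submodule K L) : Prop :=
  ∀ x ∈ H, ∀ y ∈ W, ⁅x, y⁆ ∈ W

/-- A stable subspace is the sum of its intersections with the weight spaces, and a root space,
being a line, is contained in it or meets it in zero. -/
lemma IsStable.le_of_rs_le {W W' : Submodule K L} (hW : IsStable H W)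
    (h0 : ∀ x ∈ W, x ∈ H → x ∈ W') (h : ∀ γ : H.root, rs γ ≤ W → rs γ ≤ W') : W ≤ W' := by
  let N : LieSubmodule K H L :=
    { W with lie_mem := fun {x} {y} hy ↦ hW x.1 x.2 y hy }
  have hN := eq_iSup_inf_genWeightSpace (N := N)
  have h1 : W = ⨆ χ : Weight K H L, (N ⊓ genWeightSpace L χ).toSubmodule := by
    rw [← LieSubmodule.iSup_toSubmodule, ← hN]
  rw [h1]
  refine iSup_le fun χ x hx ↦ ?_
  obtain ⟨hxW, hx⟩ : x ∈ W ∧ x ∈ genWeightSpace L χ := hx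
  by_cases hχ : χ.IsZero
  · rw [hχ.eq] at hx
    refine h0 x hxW ?_
    have hx' : x ∈ rootSpace H (0 : H → K) := hx
    rwa [rootSpace_zero_eq] at hx'
  · have hm : χ ∈ H.root := by simpa using hχ
    by_cases hx0 : x = 0
    · rw [hx0]; exact W'.zero_mem
    exact h ⟨χ, hm⟩ (le_of_mem_of_ne_zero (γ := ⟨χ, hm⟩) hx hx0 hxW) hx

lemma exists_deg_eq_intCast (b : (rootSystem H).Base) (S : Set b.support) (γ : H.root) :
    ∃ n : ℤ, deg b S ((rootSystem H).root γ) = n := by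
  rcases isPos_or_negRoot b γ with h | h
  · obtain ⟨n, hn⟩ := deg_root_of_mem b S (root_mem_closure_of_isPos b h)
    exact ⟨n, by simpa using hn⟩
  · obtain ⟨n, hn⟩ := deg_root_of_mem b S (root_mem_closure_of_isPos b h)
    rw [root_negRoot, map_neg] at hn
    exact ⟨-n, by rw [← neg_neg (deg b S _), hn]; simp⟩

lemma rs_le_grGE_iff (b : (rootSystem H).Base) (S : Set b.support) {γ : H.root} {n j : ℤ}
    (h : deg b S ((rootSystem H).root γ) = n) : rs γ ≤ grGE b S j ↔ j ≤ n := by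
  refine ⟨fun hle ↦ ?_, fun hj ↦
    (rootSpace_le_gr b S γ (by simpa using h)).trans (gr_le_grGE b S hj)⟩
  by_contra hj
  have hind := iSupIndep_genWeightSpace' K H L (γ : Weight K H L)
  rw [disjoint_iff, ← LieSubmodule.toSubmodule_inj] at hind
  obtain ⟨x, hx, hx0⟩ := exists_ne_zero_mem_rs γ
  refine hx0 ?_
  have h2 : x ∈ (⨆ χ : Weight K H L, ⨆ (_ : χ ≠ γ), genWeightSpace L χ).toSubmodule := by
    refine (?_ : grGE b S j ≤ _) (hle hx)
    refine iSup₂_le fun i hi ↦ iSup₂_le fun χ hχ ↦ ?_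
    rw [LieSubmodule.toSubmodule_le_toSubmodule]
    refine le_iSup₂_of_le χ ?_ le_rfl
    rintro rfl
    have : deg b S ((rootSystem H).root γ) = i := by simpa using hχ
    rw [h, Int.cast_inj] at this
    omega
  have h3 : x ∈ (⊥ : LieSubmodule K H L).toSubmodule := by
    rw [← hind]
    exact ⟨hx, h2⟩
  simpa using h3

lemma cartan_le_borel (b : (rootSystem H).Base) : H ≤ borel b := fun _ hx ↦
  Submodule.mem_sup_left hx

lemma rs_le_borel (b : (rootSystem H).Base) {γ : H.root} (hγ : b.IsPos γ) :
    rs γ ≤ (borel b).toSubmodule :=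
  (le_iSup₂_of_le γ hγ le_rfl).trans (le_sup_right : _ ≤ (borel b).toSubmodule)

section

variable {b : (rootSystem H).Base}

lemma IsAbelianIdeal.isStable {a : Submodule K L} (ha : IsAbelianIdeal b a) : IsStable H a :=
  fun x hx y hy ↦ ha.lie_mem x (cartan_le_borel b hx) y hy

/-- For `e` in a positive root space, `⁅x, e⁆` lies in the ideal, so `⁅x, ⁅x, e⁆⁆ = γ(x)² • e`
vanishes. Thus all roots vanish at `x`. -/
lemma IsAbelianIdeal.eq_zero_of_mem {a : Submodule K L} (ha : IsAbelianIdeal b a) {x : L}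
    (hx : x ∈ a) (hxH : x ∈ H) : x = 0 := by
  have key : ∀ γ : H.root, b.IsPos γ → (γ : Weight K H L) ⟨x, hxH⟩ = 0 := by
    intro γ hγ
    obtain ⟨e, he, he0⟩ := exists_ne_zero_mem_rs γ
    have h1 : ⁅x, e⁆ = (γ : Weight K H L) ⟨x, hxH⟩ • e := lie_eq_smul he ⟨x, hxH⟩
    have h2 : ⁅x, e⁆ ∈ a := by
      rw [← lie_skew]
      exact a.neg_mem (ha.lie_mem e (rs_le_borel b hγ he) x hx)
    have h3 := ha.lie_eq_zero x hx _ h2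
    rw [h1, lie_smul, h1, smul_smul] at h3
    simpa [he0] using h3
  have h0 : (⟨x, hxH⟩ : H) ∈ ⨅ α : Weight K H L, α.ker := by
    rw [Submodule.mem_iInf]
    intro χ
    rw [LieModule.Weight.ker, LinearMap.mem_ker]
    by_cases hχ : χ.IsZero
    · simp [hχ.eq]
    · have hm : χ ∈ H.root := by simpa using hχ
      rcases isPos_or_negRoot b ⟨χ, hm⟩ with h | h
      · simpa using key _ h
      · have := key _ h
        rw [coe_negRoot] at this
        simpa using this
  rw [iInf_ker_weight_eq_bot, Submodule.mem_bot] at h0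
  exact congrArg Subtype.val h0

lemma IsAbelianIdeal.isPos_of_rs_le {a : Submodule K L} (ha : IsAbelianIdeal b a) {γ : H.root}
    (h : rs γ ≤ a) : b.IsPos γ := by
  by_contra hγ
  have hn := (isPos_or_negRoot b γ).resolve_left hγ
  obtain ⟨e, he, f, hf, hH, h0⟩ := exists_lie_negRoot (negRoot γ)
  rw [negRoot_negRoot] at hf
  exact h0 (ha.eq_zero_of_mem (ha.lie_mem e (rs_le_borel b hn he) f (h hf)) hH)

lemma IsAbelianIdeal.ext {a a' : Submodule K L} (ha : IsAbelianIdeal b a)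
    (ha' : IsAbelianIdeal b a') (h : ∀ γ, b.IsPos γ → (rs γ ≤ a ↔ rs γ ≤ a')) : a = a' := by
  refine le_antisymm (ha.isStable.le_of_rs_le (fun x hx hxH ↦ ?_) fun γ hγ ↦ ?_)
    (ha'.isStable.le_of_rs_le (fun x hx hxH ↦ ?_) fun γ hγ ↦ ?_)
  · rw [ha.eq_zero_of_mem hx hxH]; exact a'.zero_mem
  · exact (h γ (ha.isPos_of_rs_le hγ)).1 hγ
  · rw [ha'.eq_zero_of_mem hx hxH]; exact a.zero_mem
  · exact (h γ (ha'.isPos_of_rs_le hγ)).2 hγ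

lemma deg_simple (S : Set b.support) [DecidablePred (· ∈ S)] (i : b.support) :
    deg b S ((rootSystem H).root i) = if i ∈ S then 1 else 0 := by
  have : (rootSystem H).root i = b.toWeightBasis i := by simp
  rw [this, deg, Basis.constr_basis]
  congr

lemma rs_le_par (p : Par b) {γ : H.root} (hγ : b.IsPos γ) : rs γ ≤ p.1.toSubmodule :=
  (rs_le_borel b hγ).trans p.2

lemma mem_simpleSet_iff (p : Par b) (i : b.support) :
    i ∈ simpleSet p ↔ ¬ rs (negRoot (i : H.root)) ≤ p.1.toSubmodule := by
  have h1 := rs_le_par p (RootPairing.Base.isPos_of_mem_support i.2)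
  rw [rs, coe_negRoot, simpleSet, leviRoots]
  simp only [Set.mem_ofPred_eq, not_and]
  exact ⟨fun h ↦ h h1, fun h _ ↦ h⟩

lemma simpleSet_parOf (S : Set b.support) : simpleSet (parOf b S) = S := by
  classical
  ext i
  have hd : deg b S ((rootSystem H).root (negRoot (i : H.root))) =
      ((if i ∈ S then -1 else 0 : ℤ) : K) := by
    rw [root_negRoot, map_neg, deg_simple]
    split_ifs <;> simp
  rw [mem_simpleSet_iff]
  refine (not_congr (rs_le_grGE_iff b S (j := 0) hd)).trans ?_
  split_ifs with h <;> simp [h]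

/-- Induction along simple roots: if φ = γ + α, then 𝔤_{-φ} ⊆ 𝔭 exactly when 𝔤_{-γ} and 𝔤_{-α} are,
since -γ = α + (-φ), -α = γ + (-φ), and 𝔭 contains the positive root spaces. -/
lemma rs_negRoot_le_par_iff (p : Par b) {γ : H.root} (hγ : b.IsPos γ) :
    rs (negRoot γ) ≤ p.1.toSubmodule ↔ deg b (simpleSet p) ((rootSystem H).root γ) = 0 := by
  classical
  suffices b.IsPos γ ∧ (rs (negRoot γ) ≤ p.1.toSubmodule ↔
    deg b (simpleSet p) ((rootSystem H).root γ) = 0) from this.2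
  have hsimple : ∀ i (hi : i ∈ b.support), rs (negRoot i) ≤ p.1.toSubmodule ↔
      deg b (simpleSet p) ((rootSystem H).root i) = 0 := by
    intro i hi
    have h1 := mem_simpleSet_iff p ⟨i, hi⟩
    have h2 := deg_simple (simpleSet p) ⟨i, hi⟩
    simp only at h1 h2
    rw [h2]
    split_ifs with h
    · simpa using h1.1 h
    · simpa using not_not.1 fun h' ↦ h (h1.2 h')
  refine hγ.induction_on_add (p := fun γ ↦ b.IsPos γ ∧ (rs (negRoot γ) ≤ p.1.toSubmodule ↔
    deg b (simpleSet p) ((rootSystem H).root γ) = 0))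
    (fun i hi ↦ ⟨RootPairing.Base.isPos_of_mem_support hi, hsimple i hi⟩) ?_
  rintro γ i φ hφ ⟨hpos, ih⟩ hi
  have hipos := RootPairing.Base.isPos_of_mem_support hi
  refine ⟨hpos.add hipos hφ, ?_⟩
  have hneg : (rootSystem H).root (negRoot φ) =
      (rootSystem H).root (negRoot γ) + (rootSystem H).root (negRoot i) := by
    rw [root_negRoot, root_negRoot, root_negRoot, hφ]; abel
  have h1 : rs (negRoot φ) ≤ p.1.toSubmodule ↔
      rs (negRoot γ) ≤ p.1.toSubmodule ∧ rs (negRoot i) ≤ p.1.toSubmodule := by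
    refine ⟨fun h ↦ ⟨?_, ?_⟩, fun h ↦ rs_le_of_add hneg fun x hx y hy ↦
      p.1.lie_mem (h.1 hx) (h.2 hy)⟩
    · exact rs_le_of_add (α := i) (β := negRoot φ) (by rw [hneg, root_negRoot i]; abel)
        fun x hx y hy ↦ p.1.lie_mem (rs_le_par p hipos hx) (h hy)
    · exact rs_le_of_add (α := γ) (β := negRoot φ) (by rw [hneg, root_negRoot γ]; abel)
        fun x hx y hy ↦ p.1.lie_mem (rs_le_par p hpos hx) (h hy)
  obtain ⟨m, hm⟩ := deg_root_of_mem b (simpleSet p) (root_mem_closure_of_isPos b hpos)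
  obtain ⟨n, hn⟩ := deg_root_of_mem b (simpleSet p) (root_mem_closure_of_isPos b hipos)
  rw [h1, ih, hsimple i hi, hφ, map_add, hm, hn]
  norm_cast
  omega

lemma isStable_par (p : Par b) : IsStable H p.1.toSubmodule := fun _ hx _ hy ↦
  p.1.lie_mem (p.2 (cartan_le_borel b hx)) hy

lemma parOf_simpleSet (p : Par b) : parOf b (simpleSet p) = p := by
  have key : ∀ q q' : Par b, simpleSet q = simpleSet q' → q.1.toSubmodule ≤ q'.1.toSubmodule := by
    intro q q' h
    refine (isStable_par q).le_of_rs_le (fun x _ hx ↦ q'.2 (cartan_le_borel b hx)) fun γ hγ ↦ ?_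
    rcases isPos_or_negRoot b γ with hpos | hpos
    · exact rs_le_par q' hpos
    · rw [← negRoot_negRoot γ] at hγ ⊢
      rwa [rs_negRoot_le_par_iff q' hpos, ← h, ← rs_negRoot_le_par_iff q hpos]
  have h := simpleSet_parOf (simpleSet p)
  refine Subtype.ext (LieSubalgebra.toSubmodule_injective ?_)
  exact le_antisymm (key _ _ h) (key _ _ h.symm)

lemma rs_le_f₂_parOf_iff (S : Set b.support) {γ : H.root} {n : ℤ}
    (h : deg b S ((rootSystem H).root γ) = n) :
    rs γ ≤ (f₂ b (parOf b S)).1 ↔ ht b S / 2 + 1 ≤ n := by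
  have e : (f₂ b (parOf b S)).1 = grGE b S (ht b S / 2 + 1) := by
    change grGE b (simpleSet (parOf b S)) (ht b (simpleSet (parOf b S)) / 2 + 1) = _
    rw [simpleSet_parOf]
  rw [e]
  exact rs_le_grGE_iff b S h

lemma ht_eq (S : Set b.support) {θ : H.root} (hθ : IsHighestRoot b θ) {n : ℤ}
    (h : deg b S ((rootSystem H).root θ) = n) : ht b S = n := by
  refine IsGreatest.csSup_eq ⟨?_, ?_⟩
  · intro h0
    obtain ⟨x, hx, hx0⟩ := exists_ne_zero_mem_rs θ
    have h1 := rootSpace_le_gr b S (θ : Weight K H L) (i := n) (by simpa using h) hx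
    rw [h0] at h1
    exact hx0 (by simpa using h1)
  · intro i hi
    -- Compare θ with -θ: the degree of 2θ is nonnegative.
    have hneg : (0 : ℤ) ≤ n := by
      obtain ⟨m, hm⟩ := deg_root_of_mem b S (hθ (negRoot θ))
      rw [root_negRoot, sub_neg_eq_add, map_add, h] at hm
      have : n + n = (m : ℤ) := by exact_mod_cast hm
      omega
    by_contra hlt
    refine hi ?_
    simp only [gr, iSup_eq_bot]
    intro χ hχ
    exfalso
    by_cases h0 : χ.IsZero
    · have : (χ.toLinear : Dual K H) = 0 := by ext z; simp [h0.eq]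
      rw [this, map_zero] at hχ
      have : i = 0 := by exact_mod_cast hχ.symm
      exact hlt (this ▸ hneg)
    · have hm : χ ∈ H.root := by simpa using h0
      obtain ⟨m, hm⟩ := deg_root_of_mem b S (hθ ⟨χ, hm⟩)
      rw [map_sub, h, rootSystem_root_apply, hχ] at hm
      have : n - i = (m : ℤ) := by exact_mod_cast hm
      omega

end

end AbelianIdeals

end

/-! ### Types A and C: the two maps are inverse -/

noncomputable section

namespace AbelianIdeals

open LieAlgebra LieAlgebra.IsKilling LieModule Module RootPairing.Base

variable {K L : Type*} [Field K] [CharZero K] [LieRing L] [LieAlgebra K L]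
  [FiniteDimensional K L] [IsKilling K L]
  {H : LieSubalgebra K L} [H.IsCartanSubalgebra] [IsTriangularizable K H L]
  {b : (rootSystem H).Base}

lemma IsAbelianIdeal.rs_le_of_add {a : Submodule K L} (ha : IsAbelianIdeal b a) {α β φ : H.root}
    (hα : b.IsPos α) (hβ : rs β ≤ a)
    (h : (rootSystem H).root φ = (rootSystem H).root α + (rootSystem H).root β) : rs φ ≤ a :=
  AbelianIdeals.rs_le_of_add h fun x hx y hy ↦ ha.lie_mem x (rs_le_borel b hα hx) y (hβ hy)

lemma IsAbelianIdeal.root_add_ne {a : Submodule K L} (ha : IsAbelianIdeal b a) {α β φ : H.root}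
    (hα : rs α ≤ a) (hβ : rs β ≤ a) :
    (rootSystem H).root φ ≠ (rootSystem H).root α + (rootSystem H).root β := by
  intro h
  obtain ⟨x, hx, hx0⟩ := exists_ne_zero_mem_rs α
  obtain ⟨y, hy, hy0⟩ := exists_ne_zero_mem_rs β
  exact lie_ne_zero h hx hy hx0 hy0 (ha.lie_eq_zero x (hα hx) y (hβ hy))

/-- Bracketing with 𝔤_{-α}, for α the simple root `i`, moves 𝔤_γ out of the ideal: into the root
space of `γ'`, or onto a nonzero vector of `H`, which the ideal meets only in zero. -/
lemma mem_simpleSet_f₁ (a : Ab b) (i : b.support) {γ : H.root} (h : rs γ ≤ a.1)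
    (h' : γ = i ∨ ∃ γ' : H.root,
      (rootSystem H).root γ = (rootSystem H).root i + (rootSystem H).root γ' ∧ ¬ rs γ' ≤ a.1) :
    i ∈ simpleSet (f₁ b a) := by
  rw [mem_simpleSet_iff]
  intro hle
  have hnorm : ∀ x ∈ rs (negRoot (i : H.root)), ∀ y ∈ a.1, ⁅x, y⁆ ∈ a.1 := fun x hx ↦
    (LieSubalgebra.mem_normalizer_iff _ x).1 (hle hx)
  rcases h' with rfl | ⟨γ', hγ', hn⟩
  · obtain ⟨e, he, f, hf, hH, h0⟩ := exists_lie_negRoot (i : H.root)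
    refine h0 (a.2.eq_zero_of_mem ?_ hH)
    rw [← lie_skew]
    exact a.1.neg_mem (hnorm f hf e (h he))
  · refine hn (rs_le_of_add (α := negRoot (i : H.root)) (β := γ) ?_
      fun x hx y hy ↦ hnorm x hx y (h hy))
    rw [hγ', root_negRoot]; abel

lemma le_f₁_f₂ (p : Par b) : p.1 ≤ (f₁ b (f₂ b p)).1 := by
  have key : ∀ S, (parOf b S).1 ≤ (f₁ b (f₂ b (parOf b S))).1 := by
    intro S x hx
    refine (LieSubalgebra.mem_normalizer_iff _ x).2 fun y hy ↦ ?_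
    have hy' : y ∈ grGE b (simpleSet (parOf b S))
      (ht b (simpleSet (parOf b S)) / 2 + 1) := hy
    change ⁅x, y⁆ ∈ grGE b (simpleSet (parOf b S)) (ht b (simpleSet (parOf b S)) / 2 + 1)
    rw [simpleSet_parOf] at hy' ⊢
    exact lie_mem_of_grGE b S hx hy' fun i hi ↦ gr_le_grGE b S (by omega)
  have := key (simpleSet p)
  rwa [parOf_simpleSet] at this

section Model

variable {m : ℕ} {σ : ℕ → b.support}

lemma intervalSum_mem_closure (i j : ℕ) :
    b.intervalSum σ i j ∈ AddSubmonoid.closure ((rootSystem H).root '' b.support) :=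
  AddSubmonoid.sum_mem _ fun k _ ↦ AddSubmonoid.subset_closure ⟨_, (σ k).2, rfl⟩

open Classical in
lemma deg_intervalSum (S : Set b.support) (i : ℕ) {j : ℕ} (hj : j ≤ m) :
    deg b S (b.intervalSum σ i j) =
      (({l ∈ {l ∈ Finset.range m | σ l ∈ S} | i ≤ l ∧ l < j}.card : ℤ) : K) := by
  rw [intervalSum, map_sum]
  simp_rw [deg_simple, Finset.sum_boole]
  rw [Int.cast_natCast]
  congr 2
  ext l
  simp only [Finset.mem_filter, Finset.mem_Ico, Finset.mem_range]
  constructor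
  · rintro ⟨h, h'⟩
    exact ⟨⟨by omega, h'⟩, h⟩
  · rintro ⟨⟨-, h'⟩, h⟩
    exact ⟨h, h'⟩

variable (hM : b.IsIntervalModel m σ)
include hM

lemma isHighestRoot_of_eq_intervalSum {θ : H.root}
    (hθ : (rootSystem H).root θ = b.intervalSum σ 0 m) : IsHighestRoot b θ := by
  intro γ
  rw [hθ]
  rcases isPos_or_negRoot b γ with h | h <;>
  obtain ⟨i, j, hij, hj, e⟩ := hM.exists_interval _ h
  · rw [e, intervalSum_add b σ (Nat.zero_le i) (hij.le.trans hj), intervalSum_add b σ hij.le hj]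
    convert AddSubmonoid.add_mem _ (intervalSum_mem_closure (b := b) (σ := σ) 0 i)
      (intervalSum_mem_closure (b := b) (σ := σ) j m) using 1
    abel
  · rw [root_negRoot] at e
    rw [sub_eq_add_neg, e]
    exact AddSubmonoid.add_mem _ (intervalSum_mem_closure _ _) (intervalSum_mem_closure _ _)

open Classical in
lemma ht_eq_card (hm : 0 < m) (S : Set b.support) :
    ht b S = ({l ∈ Finset.range m | σ l ∈ S}.card : ℤ) := by
  obtain ⟨θ, -, hθ⟩ := hM.exists_root hm le_rfl
  refine ht_eq S (isHighestRoot_of_eq_intervalSum hM hθ) ?_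
  rw [hθ, deg_intervalSum S 0 le_rfl, Finset.filter_true_of_mem fun l hl ↦ ?_]
  have := Finset.mem_range.1 (Finset.mem_filter.1 hl).1
  omega

-- The majority rule: the height counts all positions of members of `S`, the degree of a root those
-- in its interval.
open Classical in
lemma rs_le_f₂_iff_card (hm : 0 < m) (S : Set b.support) {γ : H.root} {i j : ℕ} (hj : j ≤ m)
    (hγ : (rootSystem H).root γ = b.intervalSum σ i j) :
    rs γ ≤ (f₂ b (parOf b S)).1 ↔ {l ∈ Finset.range m | σ l ∈ S}.card / 2 + 1 ≤
      {l ∈ {l ∈ Finset.range m | σ l ∈ S} | i ≤ l ∧ l < j}.card := by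
  rw [rs_le_f₂_parOf_iff S (n := ({l ∈ {l ∈ Finset.range m | σ l ∈ S} | i ≤ l ∧ l < j}.card : ℤ))
    (by rw [hγ, deg_intervalSum S i hj]), ht_eq_card hM hm]
  omega

lemma leftInverse_f₁_f₂ : Function.LeftInverse (f₁ b) (f₂ b) := by
  classical
  intro p
  suffices simpleSet (f₁ b (f₂ b p)) = simpleSet p by
    rw [← parOf_simpleSet (f₁ b (f₂ b p)), this, parOf_simpleSet]
  refine Set.Subset.antisymm (fun i hi ↦ ?_) fun i hi ↦ ?_
  · rw [mem_simpleSet_iff] at hi ⊢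
    exact fun h ↦ hi (h.trans (le_f₁_f₂ p))
  · obtain ⟨k, hk, rfl⟩ := hM.surj i
    obtain ⟨S, rfl⟩ : ∃ S, p = parOf b S := ⟨_, (parOf_simpleSet p).symm⟩
    rw [simpleSet_parOf] at hi
    have hm : 0 < m := by omega
    have hroot : (rootSystem H).root (σ k) = b.intervalSum σ k (k + 1) := by
      simp [intervalSum]
    have hkT : k ∈ {l ∈ Finset.range m | σ l ∈ S} :=
      Finset.mem_filter.2 ⟨Finset.mem_range.2 hk, hi⟩
    -- Shortening at `k` subtracts the simple root `σ k`, leaving a root outside the ideal, or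
    -- nothing if the interval is the single point `k`.
    rcases IntervalIdeal.exists_shortenable (m := m) (T := {l ∈ Finset.range m | σ l ∈ S})
      (fun l hl ↦ Finset.mem_range.1 (Finset.mem_filter.1 hl).1) hkT with
      ⟨j, hkj, hj, h1, h2⟩ | ⟨i, hik, h1, h2⟩
    · obtain ⟨γ, -, hγ⟩ := hM.exists_root hkj hj
      refine mem_simpleSet_f₁ _ _ ((rs_le_f₂_iff_card hM hm S hj hγ).2 h1) ?_
      rcases Nat.eq_or_lt_of_le (Nat.succ_le_of_lt hkj) with rfl | hlt
      · exact Or.inl ((rootSystem H).root.injective (hγ.trans hroot.symm))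
      · obtain ⟨γ', -, hγ'⟩ := hM.exists_root hlt hj
        refine Or.inr ⟨γ', ?_, fun h ↦ absurd ((rs_le_f₂_iff_card hM hm S hj hγ').1 h) ?_⟩
        · rw [hγ, hγ', intervalSum_succ_left b σ hkj]
        · exact not_le.2 h2
    · obtain ⟨γ, -, hγ⟩ := hM.exists_root (Nat.lt_succ_of_le hik) (Nat.succ_le_of_lt hk)
      refine mem_simpleSet_f₁ _ _ ((rs_le_f₂_iff_card hM hm S hk hγ).2 h1) ?_
      rcases Nat.eq_or_lt_of_le hik with rfl | hlt
      · exact Or.inl ((rootSystem H).root.injective (hγ.trans hroot.symm))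
      · obtain ⟨γ', -, hγ'⟩ := hM.exists_root hlt hk.le
        refine Or.inr ⟨γ', ?_, fun h ↦ absurd ((rs_le_f₂_iff_card hM hm S hk.le hγ').1 h) ?_⟩
        · rw [hγ, hγ', intervalSum_succ_right b σ hik, add_comm]
        · exact not_le.2 h2

omit hM in
lemma intervalSum_reflect (hσ : ∀ i < m, σ (m - 1 - i) = σ i) {i j : ℕ} (hj : j ≤ m) :
    b.intervalSum σ (m - j) (m - i) = b.intervalSum σ i j := by
  refine Finset.sum_nbij' (fun k ↦ m - 1 - k) (fun k ↦ m - 1 - k) ?_ ?_ ?_ ?_ ?_ <;>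
  intro k hk <;> rw [Finset.mem_Ico] at hk
  · rw [Finset.mem_Ico]; omega
  · rw [Finset.mem_Ico]; omega
  · omega
  · omega
  · rw [hσ k (by omega)]

lemma surjective_f₂ (hm : 0 < m) : Function.Surjective (f₂ b) := by
  classical
  rintro ⟨a, ha⟩
  set I : ℕ → ℕ → Prop := fun i j ↦ (i < j ∧ j ≤ m) ∧
    ∃ γ : H.root, (rootSystem H).root γ = b.intervalSum σ i j ∧ rs γ ≤ a with hI
  have hIroot : ∀ {i j γ}, i < j → j ≤ m → (rootSystem H).root γ = b.intervalSum σ i j →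
      (I i j ↔ rs γ ≤ a) := by
    intro i j γ hij hj hγ
    refine ⟨?_, fun h ↦ ⟨⟨hij, hj⟩, γ, hγ, h⟩⟩
    rintro ⟨-, δ, hδ, h⟩
    rwa [(rootSystem H).root.injective (hγ.trans hδ.symm)]
  have upl : ∀ {i j i'}, I i j → i' ≤ i → I i' j := by
    rintro i j i' ⟨⟨hij, hj⟩, γ, hγ, hle⟩ hi
    rcases Nat.eq_or_lt_of_le hi with rfl | hi
    · exact ⟨⟨hij, hj⟩, γ, hγ, hle⟩
    obtain ⟨δ, hδ, eδ⟩ := hM.exists_root hi (hij.le.trans hj)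
    obtain ⟨φ, -, eφ⟩ := hM.exists_root (hi.trans hij) hj
    refine ⟨⟨hi.trans hij, hj⟩, φ, eφ, ha.rs_le_of_add hδ hle ?_⟩
    rw [eφ, eδ, hγ, intervalSum_add b σ hi.le hij.le]
  have upr : ∀ {i j j'}, I i j → j ≤ j' → j' ≤ m → I i j' := by
    rintro i j j' ⟨⟨hij, hj⟩, γ, hγ, hle⟩ hjj hj'
    rcases Nat.eq_or_lt_of_le hjj with rfl | hjj
    · exact ⟨⟨hij, hj⟩, γ, hγ, hle⟩
    obtain ⟨δ, hδ, eδ⟩ := hM.exists_root hjj hj'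
    obtain ⟨φ, -, eφ⟩ := hM.exists_root (hij.trans hjj) hj'
    refine ⟨⟨hij.trans hjj, hj'⟩, φ, eφ, ha.rs_le_of_add hδ hle ?_⟩
    rw [eφ, eδ, hγ, intervalSum_add b σ hij.le hjj.le, add_comm]
  have hab : ∀ {i j k}, I i j → I j k → False := by
    rintro i j k ⟨⟨hij, hj⟩, γ, hγ, hle⟩ ⟨⟨hjk, hk⟩, δ, hδ, hle'⟩
    obtain ⟨φ, -, eφ⟩ := hM.exists_root (hij.trans hjk) hk
    exact ha.root_add_ne hle hle' (φ := φ)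
      (by rw [eφ, hγ, hδ, intervalSum_add b σ hij.le hjk.le])
  set T : Finset ℕ := {k ∈ Finset.range m |
    (∃ j, I k j ∧ ¬ I (k + 1) j) ∨ ∃ i, I i (k + 1) ∧ ¬ I i k} with hT
  have mT : ∀ k, k ∈ T ↔ (∃ j, I k j ∧ ¬ I (k + 1) j) ∨ ∃ i, I i (k + 1) ∧ ¬ I i k := by
    intro k
    rw [hT, Finset.mem_filter, Finset.mem_range, and_iff_right_iff_imp]
    rintro (⟨j, h, -⟩ | ⟨i, h, -⟩) <;> have := h.1 <;> omega
  set S : Set b.support := σ '' T with hS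
  -- `T` must contain every position of a simple root as soon as it contains one. In the palindromic
  -- case reflected intervals have the same sum, so `I` is symmetric; reflection exchanges left and
  -- right shortening and preserves `T`.
  have hTS : {l ∈ Finset.range m | σ l ∈ S} = T := by
    ext l
    rw [Finset.mem_filter, Finset.mem_range]
    refine ⟨?_, fun hl ↦ ⟨Finset.mem_range.1 (Finset.mem_filter.1 hl).1, l, hl, rfl⟩⟩
    rintro ⟨hl, k, hk, e⟩
    have hk' : k ∈ T := hk
    have hkm := Finset.mem_range.1 (Finset.mem_filter.1 hk').1
    rcases hM.fold k hkm l hl e with rfl | ⟨hsum, hsym⟩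
    · exact hk'
    have hrefl : ∀ {i j}, i ≤ m → j ≤ m → (I (m - j) (m - i) ↔ I i j) := by
      intro i j hi hj
      simp only [hI, intervalSum_reflect hsym hj]
      refine and_congr ?_ Iff.rfl
      omega
    rw [mT] at hk' ⊢
    rcases hk' with ⟨j, h1, h2⟩ | ⟨i, h1, h2⟩
    · have hj := h1.1
      refine Or.inr ⟨m - j, ?_, ?_⟩
      · rwa [show l + 1 = m - k by omega, hrefl (by omega) hj.2]
      · rwa [show l = m - (k + 1) by omega, hrefl (by omega) hj.2]
    · have hi := h1.1
      refine Or.inl ⟨m - i, ?_, ?_⟩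
      · rwa [show l = m - (k + 1) by omega, hrefl (by omega) hi.2]
      · rwa [show l + 1 = m - k by omega, hrefl (by omega) (by omega)]
  refine ⟨parOf b S, Subtype.ext ?_⟩
  refine (f₂ b (parOf b S)).2.ext ha fun γ hγ ↦ ?_
  obtain ⟨i, j, hij, hj, e⟩ := hM.exists_interval γ hγ
  rw [rs_le_f₂_iff_card hM hm S hj e, hTS, ← hIroot hij hj e]
  exact (IntervalIdeal.mem_iff_card (m := m) (I := I) (fun h ↦ h.1)
    (fun h hi hj hj' ↦ upl (upr h hj hj') hi) hab T mT hj).symm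

end Model

end AbelianIdeals

end

/-! ### The case where the highest root is a fundamental weight -/

noncomputable section

namespace AbelianIdeals

open LieAlgebra LieAlgebra.IsKilling LieModule Module RootPairing.Base

variable {K L : Type*} [Field K] [CharZero K] [LieRing L] [LieAlgebra K L]
  [FiniteDimensional K L] [IsKilling K L]
  {H : LieSubalgebra K L} [H.IsCartanSubalgebra] [IsTriangularizable K H L]
  {b : (rootSystem H).Base}

lemma deg_insert {S : Set b.support} {i : b.support} (hi : i ∉ S) :
    deg b (insert i S) = deg b S + deg b {i} := by
  classical
  refine b.toWeightBasis.ext fun j ↦ ?_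
  rw [toWeightBasis_apply, LinearMap.add_apply, deg_simple, deg_simple, deg_simple]
  by_cases hj : j = i
  · subst hj; simp [hi]
  · simp [hj]

lemma eq_zero_of_deg_univ_eq_zero {v : Dual K H}
    (hv : v ∈ AddSubmonoid.closure ((rootSystem H).root '' b.support))
    (h0 : deg b Set.univ v = 0) : v = 0 := by
  classical
  suffices ∃ n : ℕ, deg b Set.univ v = n ∧ (n = 0 → v = 0) by
    obtain ⟨n, hn, h⟩ := this
    exact h (by rw [h0] at hn; exact_mod_cast hn.symm)
  clear h0
  induction hv using AddSubmonoid.closure_induction with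
  | mem v hv =>
    obtain ⟨i, hi, rfl⟩ := hv
    exact ⟨1, by simpa using deg_simple Set.univ (⟨i, hi⟩ : b.support), by simp⟩
  | zero => exact ⟨0, by simp⟩
  | add v w _ _ hv hw =>
    obtain ⟨m, hm, hm'⟩ := hv
    obtain ⟨n, hn, hn'⟩ := hw
    exact ⟨m + n, by simp [hm, hn], fun h ↦ by rw [hm' (by omega), hn' (by omega), add_zero]⟩

lemma coroot_root_eq_intCast (γ δ : H.root) :
    (rootSystem H).coroot' δ ((rootSystem H).root γ) = ((rootSystem H).pairingIn ℤ γ δ : K) := by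
  rw [(rootSystem H).root_coroot'_eq_pairing, ← (rootSystem H).algebraMap_pairingIn ℤ, eq_intCast]

lemma pairingIn_negRoot (γ δ : H.root) :
    (rootSystem H).pairingIn ℤ (negRoot γ) δ = -(rootSystem H).pairingIn ℤ γ δ := by
  have h := coroot_root_eq_intCast (negRoot γ) δ
  rw [root_negRoot, map_neg, coroot_root_eq_intCast] at h
  exact_mod_cast h.symm

section

variable {θ : H.root} (hθ : IsHighestRoot b θ)
include hθ

/-- If the pairing is k ≥ 2, comparing θ with the root kθ - γ bounds the height of γ below by k - 1
times that of θ. So the heights agree, and γ = θ. -/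
lemma pairingIn_highestRoot_le_one {γ : H.root} (hγ : γ ≠ θ) :
    (rootSystem H).pairingIn ℤ γ θ ≤ 1 := by
  by_contra! hk
  set k := (rootSystem H).pairingIn ℤ γ θ with hkdef
  set δ := (rootSystem H).reflectionPerm θ γ with hδ
  have eδ : (rootSystem H).root δ = (rootSystem H).root γ - (k : K) • (rootSystem H).root θ := by
    rw [hδ, (rootSystem H).root_reflectionPerm, (rootSystem H).reflection_apply,
      coroot_root_eq_intCast]
  obtain ⟨p, hp⟩ := deg_root_of_mem b Set.univ (hθ (negRoot δ))
  obtain ⟨q, hq⟩ := deg_root_of_mem b Set.univ (hθ (negRoot θ))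
  obtain ⟨r, hr⟩ := deg_root_of_mem b Set.univ (hθ γ)
  obtain ⟨x, hx⟩ := exists_deg_eq_intCast b Set.univ θ
  obtain ⟨y, hy⟩ := exists_deg_eq_intCast b Set.univ γ
  rw [root_negRoot, eδ, map_sub, map_neg, map_sub, map_smul, hx, hy, smul_eq_mul] at hp
  rw [root_negRoot, map_sub, map_neg, hx] at hq
  have hr' := hr
  rw [map_sub, hx, hy] at hr'
  have hp' : x - -(y - k * x) = p := by exact_mod_cast hp
  have hq' : x - -x = q := by exact_mod_cast hq
  have hr'' : x - y = r := by exact_mod_cast hr'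
  have h1 : x ≤ (k - 1) * x := le_mul_of_one_le_left (by omega) (by omega)
  have hr0 : (r : ℤ) = 0 := by nlinarith
  have h2 := eq_zero_of_deg_univ_eq_zero (hθ γ) (by rw [hr]; exact_mod_cast hr0)
  exact hγ ((rootSystem H).root.injective (sub_eq_zero.1 h2).symm)

lemma neg_one_le_pairingIn_highestRoot {γ : H.root} (hγ : γ ≠ negRoot θ) :
    -1 ≤ (rootSystem H).pairingIn ℤ γ θ := by
  have h := pairingIn_highestRoot_le_one hθ (γ := negRoot γ) fun h ↦ hγ <| by
    rw [← h, negRoot_negRoot]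
  rw [pairingIn_negRoot] at h
  omega

variable {i : b.support} (hi : (rootSystem H).pairingIn ℤ θ i = 1)
  (hj : ∀ j : b.support, j ≠ i → (rootSystem H).pairingIn ℤ θ j = 0)
include hi

lemma pairingIn_simple_highestRoot : (rootSystem H).pairingIn ℤ i θ = 1 := by
  have hne : (i : H.root) ≠ θ := by
    rintro rfl
    rw [(rootSystem H).pairingIn_same] at hi
    omega
  have h1 := pairingIn_highestRoot_le_one hθ hne
  have h2 : 0 < (rootSystem H).pairingIn ℤ i θ := by
    rw [(rootSystem H).zero_lt_pairingIn_iff', hi]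
    exact Int.one_pos
  omega

include hj

lemma deg_singleton_eq_coroot : deg b {i} = (rootSystem H).coroot' θ := by
  classical
  refine b.toWeightBasis.ext fun j ↦ ?_
  rw [toWeightBasis_apply, deg_simple, coroot_root_eq_intCast]
  by_cases h : j = i
  · rw [h, pairingIn_simple_highestRoot hθ hi]; simp
  · rw [(rootSystem H).pairingIn_eq_zero_iff.2 (hj j h)]; simp [h]

-- With k the pairing to be bounded, the reflected root γ - kα pairs to -k with θ^∨. That lies
-- between -1 and 1 unless the reflected root is ±θ, and then its pairing with α^∨, also -k, is ±1.
omit hj in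
lemma abs_pairingIn_le_one {γ : H.root} (hγ : (rootSystem H).pairingIn ℤ γ θ = 0) :
    |(rootSystem H).pairingIn ℤ γ i| ≤ 1 := by
  set k := (rootSystem H).pairingIn ℤ γ i with hk
  set δ := (rootSystem H).reflectionPerm i γ with hδ
  have eδ : (rootSystem H).root δ = (rootSystem H).root γ - (k : K) • (rootSystem H).root i := by
    rw [hδ, (rootSystem H).root_reflectionPerm, (rootSystem H).reflection_apply,
      coroot_root_eq_intCast]
  have h1 : (rootSystem H).pairingIn ℤ δ θ = -k := by
    have h := coroot_root_eq_intCast δ θ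
    rw [eδ, map_sub, map_smul, coroot_root_eq_intCast, coroot_root_eq_intCast, hγ,
      pairingIn_simple_highestRoot hθ hi] at h
    have h' : (((rootSystem H).pairingIn ℤ δ θ : ℤ) : K) = ((-k : ℤ) : K) := by
      rw [← h]; simp
    exact_mod_cast h'
  have h2 : (rootSystem H).pairingIn ℤ δ i = -k := by
    have h := coroot_root_eq_intCast δ i
    rw [eδ, map_sub, map_smul, coroot_root_eq_intCast, coroot_root_eq_intCast, ← hk,
      (rootSystem H).pairingIn_same] at h
    have h' : (((rootSystem H).pairingIn ℤ δ i : ℤ) : K) = ((k - k * 2 : ℤ) : K) := by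
      rw [← h]; simp
    have h'' : (rootSystem H).pairingIn ℤ δ i = k - k * 2 := by exact_mod_cast h'
    omega
  by_cases hp : δ = θ
  · rw [hp, hi] at h2
    rw [abs_le]; omega
  by_cases hn : δ = negRoot θ
  · rw [hn, pairingIn_negRoot, hi] at h2
    rw [abs_le]; omega
  have h3 := pairingIn_highestRoot_le_one hθ hp
  have h4 := neg_one_le_pairingIn_highestRoot hθ hn
  rw [abs_le]; omega

/-- Simple roots other than α are orthogonal to θ, so `abs_pairingIn_le_one` leaves only the values
0 and -1 for their pairings with α^∨. -/
lemma coroot_eq_two_smul_deg_sub_deg :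
    (rootSystem H).coroot' i = (2 : K) • deg b {i} - deg b (adjacent b i) := by
  classical
  refine b.toWeightBasis.ext fun j ↦ ?_
  rw [toWeightBasis_apply, LinearMap.sub_apply, LinearMap.smul_apply, deg_simple, deg_simple,
    coroot_root_eq_intCast]
  by_cases h : j = i
  · rw [h, (rootSystem H).pairingIn_same]; simp [adjacent]
  have h0 : (rootSystem H).pairingIn ℤ j θ = 0 := (rootSystem H).pairingIn_eq_zero_iff.2 (hj j h)
  have h1 := abs_le.1 (abs_pairingIn_le_one hθ hi h0)
  have h2 : (rootSystem H).pairingIn ℤ j i ≤ 0 :=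
    b.pairingIn_le_zero_of_ne (fun e ↦ h (Subtype.ext e)) j.2 i.2
  have h3 : (rootSystem H).pairing j i = ((rootSystem H).pairingIn ℤ j i : K) := by
    rw [← (rootSystem H).algebraMap_pairingIn ℤ, eq_intCast]
  by_cases hadj : j ∈ adjacent b i
  · have h4 : (rootSystem H).pairingIn ℤ j i ≠ 0 := fun e ↦ hadj.2 (by rw [h3, e, Int.cast_zero])
    rw [show (rootSystem H).pairingIn ℤ j i = -1 by omega]
    simp [h, hadj]
  · have h4 : (rootSystem H).pairingIn ℤ j i = 0 := by
      by_contra e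
      exact hadj ⟨h, by rw [h3]; exact_mod_cast e⟩
    rw [h4]
    simp [h, hadj]

lemma f₂_parOf_adjacent_eq :
    f₂ b (parOf b (adjacent b i)) = f₂ b (parOf b (insert i (adjacent b i))) := by
  have hni : i ∉ adjacent b i := fun h ↦ h.1 rfl
  have hc : ∀ γ : H.root, deg b {i} ((rootSystem H).root γ) =
      ((rootSystem H).pairingIn ℤ γ θ : K) := fun γ ↦ by
    rw [deg_singleton_eq_coroot hθ hi hj, coroot_root_eq_intCast]
  have hd : ∀ γ : H.root, deg b (adjacent b i) ((rootSystem H).root γ) =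
      ((2 * (rootSystem H).pairingIn ℤ γ θ - (rootSystem H).pairingIn ℤ γ i : ℤ) : K) := fun γ ↦ by
    have h := LinearMap.congr_fun (coroot_eq_two_smul_deg_sub_deg hθ hi hj) ((rootSystem H).root γ)
    rw [LinearMap.sub_apply, LinearMap.smul_apply, hc, coroot_root_eq_intCast] at h
    push_cast
    rw [h, smul_eq_mul]
    ring
  have hd' : ∀ γ : H.root, deg b (insert i (adjacent b i)) ((rootSystem H).root γ) =
      ((3 * (rootSystem H).pairingIn ℤ γ θ - (rootSystem H).pairingIn ℤ γ i : ℤ) : K) := fun γ ↦ by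
    rw [deg_insert hni, LinearMap.add_apply, hc, hd]
    push_cast
    ring
  have hss : (rootSystem H).pairingIn ℤ θ θ = 2 := by
    rw [(rootSystem H).pairingIn_same]
  have ht1 := ht_eq _ hθ (hd θ)
  have ht2 := ht_eq _ hθ (hd' θ)
  rw [hss, hi] at ht1 ht2
  refine Subtype.ext ((f₂ b _).2.ext (f₂ b _).2 fun γ hγ ↦ ?_)
  rw [rs_le_f₂_parOf_iff _ (hd γ), rs_le_f₂_parOf_iff _ (hd' γ), ht1, ht2]
  obtain ⟨n, hn⟩ := deg_root_of_mem b {i} (root_mem_closure_of_isPos b hγ)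
  rw [hc] at hn
  have hn' : (rootSystem H).pairingIn ℤ γ θ = n := by exact_mod_cast hn
  -- If ⟨γ,θ^∨⟩ = 1, degree and threshold both rise by one from S₁ to S₂. If it is 0, both degrees
  -- are at most 1, below either threshold.
  by_cases h : γ = θ
  · rw [h, hss, hi]; norm_num
  · have h1 := pairingIn_highestRoot_le_one hθ h
    by_cases h0 : (rootSystem H).pairingIn ℤ γ θ = 0
    · have h2 := abs_le.1 (abs_pairingIn_le_one hθ hi h0)
      omega
    · omega

end

end AbelianIdeals

end

/-! ### The theorem -/

open AbelianIdeals in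
theorem theorem4p3 {L : Type*} [LieRing L] [LieAlgebra ℂ L] [FiniteDimensional ℂ L]
    [LieAlgebra.IsSimple ℂ L] (H : LieSubalgebra ℂ L) [H.IsCartanSubalgebra]
    (b : (LieAlgebra.IsKilling.rootSystem H).Base) :
    (IsTypeA b ∨ IsTypeC b →
      Function.Bijective (f₂ b) ∧
        Function.LeftInverse (f₂ b) (f₁ b) ∧ Function.RightInverse (f₂ b) (f₁ b)) ∧
    (∀ θ : H.root, IsHighestRoot b θ → IsFundamental b θ →
      ¬ Function.Injective (f₂ b) ∧ ¬ Function.Bijective (f₂ b) ∧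
      ∃ αθ : b.support,
        (∀ β : b.support, (LieAlgebra.IsKilling.rootSystem H).pairing θ β ≠ 0 ↔ β = αθ) ∧
        parOf b (adjacent b αθ) ≠ parOf b (insert αθ (adjacent b αθ)) ∧
        f₂ b (parOf b (adjacent b αθ)) = f₂ b (parOf b (insert αθ (adjacent b αθ)))) := by
  refine ⟨fun htype ↦ ?_, fun θ hθ ⟨i, his, hi, hj⟩ ↦ ?_⟩
  -- Roots exist because they span the dual of `H`, which is nontrivial by irreducibility. Hence the
  -- sequence of simple roots is not empty.
  · have : Nonempty H.root := by
      by_contra hne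
      rw [not_nonempty_iff] at hne
      have h0 := RootPairing.IsRootSystem.span_root_eq_top (P := LieAlgebra.IsKilling.rootSystem H)
      rw [Set.range_eq_empty, Submodule.span_empty] at h0
      have := RootPairing.IsIrreducible.nontrivial (LieAlgebra.IsKilling.rootSystem H)
      exact bot_ne_top h0
    have : Nonempty b.support := b.support_nonempty.to_subtype
    obtain ⟨m, σ, hM⟩ : ∃ m σ, b.IsIntervalModel m σ := by
      rcases htype with ⟨n, e, he⟩ | ⟨n, e, he⟩
      · exact RootPairing.Base.exists_isIntervalModel_of_typeA e he
      · exact RootPairing.Base.exists_isIntervalModel_of_typeC e he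
    have hm : 0 < m := by
      obtain ⟨k, hk, -⟩ := hM.surj (Classical.arbitrary _)
      omega
    have hl := leftInverse_f₁_f₂ hM
    have hs := surjective_f₂ hM hm
    exact ⟨⟨hl.injective, hs⟩, hl.rightInverse_of_surjective hs, hl⟩
  · have hcast : ∀ γ δ : H.root, (LieAlgebra.IsKilling.rootSystem H).pairing γ δ =
        ((LieAlgebra.IsKilling.rootSystem H).pairingIn ℤ γ δ : ℂ) := fun γ δ ↦ by
      rw [← (LieAlgebra.IsKilling.rootSystem H).algebraMap_pairingIn ℤ, eq_intCast]
    set α : b.support := ⟨i, his⟩ with hα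
    have h1 : (LieAlgebra.IsKilling.rootSystem H).pairingIn ℤ θ α = 1 := by
      have h := hi
      rw [hcast] at h
      exact_mod_cast h
    have h2 : ∀ j : b.support, j ≠ α →
        (LieAlgebra.IsKilling.rootSystem H).pairingIn ℤ θ j = 0 := fun j hjα ↦ by
      have h := hj j j.2 fun e ↦ hjα (Subtype.ext e)
      rw [hcast] at h
      exact_mod_cast h
    have heq := f₂_parOf_adjacent_eq hθ h1 h2
    have hne : parOf b (adjacent b α) ≠ parOf b (insert α (adjacent b α)) := by
      intro h
      have h3 := congrArg simpleSet h
      rw [simpleSet_parOf, simpleSet_parOf] at h3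
      have h4 : α ∈ adjacent b α := by rw [h3]; exact Set.mem_insert _ _
      exact h4.1 rfl
    have hinj : ¬ Function.Injective (f₂ b) := fun h ↦ hne (h heq)
    refine ⟨hinj, fun h ↦ hinj h.1, α, fun β ↦ ⟨fun hβ ↦ ?_, ?_⟩, hne, heq⟩
    · by_contra hβα
      exact hβ (by rw [hcast, h2 β hβα, Int.cast_zero])
    · rintro rfl
      rw [hcast, h1]
      simp
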